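/- **Setting.** Let $u:[0,\infty)\to\mathbb R$ be càdlàg, with left limits $u_{t-}$ (and $u_{0-}:=u_0$) and jumps $\Delta u_t=u_t-u_{t-}$. For $z\in\mathbb H=\{\operatorname{Im}z>0\}$ let $g_t(z)$ be the solution of the Loewner equation $$\partial_t g_t(z)=\frac{2}{g_t(z)-u_t},\qquad g_0(z)=z,$$ with right derivatives in $t$, as long as $g_s(z)\ne u_s$ and $g_s(z)\neq u_{s-}$. Let $H_t$ be the set of $z\in\mathbb H$ for which the solution exists up to and including time $t$. Put $f_t=g_t^{-1}:\mathbb H\to H_t$ and $\hat f_t(z)=f_t(z+u_t)$; a prime denotes the derivative in $z$. For $\beta>0$ and $j\ge1$ put $$u_{j,t}=u_t-\sum_{0\le s\le t}\Delta u_s\,\mathbf 1_{\{|\Delta u_s|>2^{-\beta j}\}}.$$ **Lemma 4.1.** Let $\beta>1$, let $L,N$ be positive integers, and let $(r_j)_{j\ge1}$ be a nondecreasing sequence of positive integers with $\sum_{j\ge1}1/r_j<\infty$. Suppose there are a constant $c>0$ and an integer $j_0>0$ such that for all integers $j\ge j_0$ and $0\le k\le N2^{2j}-1$ there are points $$t(j,k,1)\le\dots\le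 t(j,k,L),\qquad s(j,k,1)\le\dots\le s(j,k,r_j)$$ in $[k2^{-2j},(k+1)2^{-2j})$ such that, with $s(j,k,0)=k2^{-2j}$ and $s(j,k,r_j+1)=(k+1)2^{-2j}$, 1. $\{t\in[k2^{-2j},(k+1)2^{-2j}):|\Delta u_t|>2^{-\beta j}\}\subseteq\{t(j,k,l):1\le l\le L\}$; 2. $|u_{j,b}-u_{j,a}|\le c\,2^{-j}$ whenever $0\le l\le r_j$ and $a,b\in[s(j,k,l),s(j,k,l+1))$; 3. $|\hat f_{t(j,k,l)}'(i2^{-j}-\Delta u_{t(j,k,l)})|\le 2^j/r_j^2$ for $1\le l\le L$; 4. $|\hat f_{s(j,k,m)}'(i2^{-j})|\le 2^j/r_j^2$ for $0\le m\le r_j+1$. Then the limit $\gamma(t)=\lim_{y\downarrow0}\hat f_t(iy)\in\mathbb C$ exists for every $t\in[0,N]$, and $\gamma$ is càdlàg on $[0,N)$, that is, right-continuous on $[0,N)$ with left limits at each point of $(0,N)$. If moreover the bound in 3 also holds at the final time $N$, that is, $$|\hat f_N'(i2^{-j}-\Delta u_N)|\le 2^j/r_j^2\qquad\text{for all } j\ge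 j_0$$ (by 4 this is automatic if $u$ does not jump at $N$), then $\gamma$ is càdlàg on $[0,N]$. -/

import Mathlib

open Set Filter Topology

/-- `f` is càdlàg on `I`: at each point of `I` it is right-continuous and has a left limit, both
taken within `I`. -/
def CadlagOn {E : Type*} [TopologicalSpace E] (f : ℝ → E) (I : Set ℝ) : Prop :=
  ∀ t ∈ I, ContinuousWithinAt f (I ∩ Ici t) t ∧ ∃ l : E, Tendsto f (𝓝[I ∩ Iio t] t) (𝓝 l)

/-- The left limit `u_{t-}` of a function on `[0,∞)`, with `u_{0-} = u_0`. -/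
noncomputable def leftValue (u : ℝ → ℝ) (t : ℝ) : ℝ :=
  if 0 < t then Function.leftLim u t else u t

/-- The jump `Δu_t = u_t - u_{t-}`. -/
noncomputable def jump (u : ℝ → ℝ) (t : ℝ) : ℝ := u t - leftValue u t

/-- `u_{j,t} = u_t - ∑_{0 ≤ s ≤ t} Δu_s 1_{|Δu_s| > 2^{-βj}}`; for càdlàg `u` only finitely many
terms occur. -/
noncomputable def truncated (u : ℝ → ℝ) (β : ℝ) (j : ℕ) (t : ℝ) : ℝ :=
  u t - ∑ᶠ s ∈ {s : ℝ | s ∈ Icc 0 t ∧ (2 : ℝ) ^ (-β * j) < |jump u s|}, jump u s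

/-- `w` solves the chordal Loewner equation `∂ₛ w = 2 / (w - u)` (right derivatives) on `[0,T]`,
started at `z`, and meets neither `u_s` nor `u_{s-}` up to and including time `T`. -/
structure IsLoewnerSolution (u : ℝ → ℝ) (T : ℝ) (z : ℂ) (w : ℝ → ℂ) : Prop where
  initial : w 0 = z
  continuousOn : ContinuousOn w (Icc 0 T)
  ne_driving : ∀ s ∈ Icc 0 T, w s ≠ (u s : ℂ) ∧ w s ≠ (leftValue u s : ℂ)
  rightDeriv : ∀ s ∈ Ico 0 T, HasDerivWithinAt w (2 / (w s - (u s : ℂ))) (Ici s) s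

/-- `H_t = ℍ \ K_t`: the points of the open upper half-plane whose solution is alive at time `t`
(that is, `t < ζ(z)`). -/
def loewnerDomain (u : ℝ → ℝ) (t : ℝ) : Set ℂ :=
  {z : ℂ | 0 < z.im ∧ ∃ w : ℝ → ℂ, IsLoewnerSolution u t z w}

open Classical in
/-- `g_t(z)`, the value at time `t` of the solution started at `z` (`0` if there is none). -/
noncomputable def loewnerMap (u : ℝ → ℝ) (t : ℝ) (z : ℂ) : ℂ :=
  if h : ∃ w : ℝ → ℂ, IsLoewnerSolution u t z w then h.choose t else 0

/-- `f_t = g_t⁻¹ : ℍ → H_t`. -/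
noncomputable def loewnerInv (u : ℝ → ℝ) (t : ℝ) : ℂ → ℂ :=
  Function.invFunOn (loewnerMap u t) (loewnerDomain u t)

/-- `f̂_t(z) = f_t(z + u_t)`. -/
noncomputable def loewnerInvHat (u : ℝ → ℝ) (t : ℝ) (z : ℂ) : ℂ :=
  loewnerInv u t (z + (u t : ℂ))

/-! For each fixed j, the map τ ↦ f̂_τ(i2^{-j}) is càdlàg: at a positive height the backward flow
depends continuously on its starting time and point (`tendsto_loewnerInvHat`). So it suffices that
these maps converge locally uniformly in τ (`CadlagOn.of_uniform`). If |f̂_τ'(i2^{-j})| ≤ K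
2^j/r_j², distortion bounds the oscillation of f̂_τ over heights in [2^{-j-1}, 2^{-j}] by a constant
times 1/r_j², which is summable.

The hypotheses give this bound only at marked times; `norm_deriv_loewnerInvHat_le_of_block` carries
it to every τ. Write y = 2^{-j} and let b be the first time after τ that is a large jump or the next
point s. Between τ and b- the driving function moves by at most cy. Since b - τ ≤ y², the backward
flow from b to τ moves a point of height y by at most 2y and its derivative has modulus at least
e^{-2}. The chain rule and distortion then compare time τ with time b, starting from iy + u_{b-} at
a large jump (bound 3) and from iy + u_b otherwise (bound 4).

Distortion is derived from the flow itself. With p, q the Cauchy kernels 1/(w - u) along two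
trajectories, the logarithm of the difference quotient is ∫ 2pq, so the Grunsky combination is ∫ 2(p
- q)². Pairing with reflected trajectories evaluates ∫ 2|p - q|² in closed form, which bounds it
(`norm_logQuotient_add_sub_le`). Together with the fact that difference quotients have no zeros,
this yields a Koebe-type estimate (`norm_exp_logQuotient_le`).

The jump at the right end of a block is a jump of the next block; only the final time N has no next
block. Hence the bounds are uniform on [0, a] for a < N, and on [0, N] under the extra hypothesis at
N. -/

/-! ### Calculus with right-continuous integrands. -/

section RightContinuous

open MeasureTheory intervalIntegral

/-- A right-continuous function on the line is measurable. -/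
theorem measurable_of_rightContinuous {E : Type*} [TopologicalSpace E]
    [TopologicalSpace.PseudoMetrizableSpace E] [MeasurableSpace E] [BorelSpace E] {q : ℝ → E}
    (hq : ∀ s, ContinuousWithinAt q (Ici s) s) : Measurable q := by
  -- The sample point is the first multiple of 1/(n+1) strictly to the right of s, so right
  -- continuity applies; as a function of s the sampled value factors through the discrete space ℤ
  -- and is measurable.
  have hlim : ∀ s : ℝ, Tendsto (fun n : ℕ => q ((⌊((n : ℝ) + 1) * s⌋ + 1 : ℤ) / ((n : ℝ) + 1)))
      atTop (𝓝 (q s)) := by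
    intro s
    refine (hq s).tendsto.comp (tendsto_nhdsWithin_iff.2 ⟨?_, ?_⟩)
    · have h0 : Tendsto (fun n : ℕ => s + 1 / ((n : ℝ) + 1)) atTop (𝓝 s) := by
        simpa using (tendsto_const_nhds (x := s)).add
          (tendsto_one_div_add_atTop_nhds_zero_nat (𝕜 := ℝ))
      refine tendsto_of_tendsto_of_tendsto_of_le_of_le tendsto_const_nhds h0 ?_ ?_
      · intro n
        have hn : (0 : ℝ) < n + 1 := by positivity
        rw [le_div_iff₀ hn]
        push_cast
        linarith [Int.lt_floor_add_one (((n : ℝ) + 1) * s)]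
      · intro n
        have hn : (0 : ℝ) < n + 1 := by positivity
        simp only
        rw [div_le_iff₀ hn, add_mul s, one_div, inv_mul_cancel₀ hn.ne']
        push_cast
        linarith [Int.floor_le (((n : ℝ) + 1) * s)]
    · refine Eventually.of_forall fun n => ?_
      have hn : (0 : ℝ) < n + 1 := by positivity
      rw [mem_Ici, le_div_iff₀ hn]
      push_cast
      linarith [Int.lt_floor_add_one (((n : ℝ) + 1) * s)]
  refine measurable_of_tendsto_metrizable (f := fun (n : ℕ) s =>
    q ((⌊((n : ℝ) + 1) * s⌋ + 1 : ℤ) / ((n : ℝ) + 1))) (fun n => ?_) (tendsto_pi_nhds.2 hlim)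
  have h1 : Measurable fun m : ℤ => q ((m + 1 : ℤ) / ((n : ℝ) + 1)) := measurable_from_top
  exact h1.comp (Int.measurable_floor.comp (measurable_const.mul measurable_id))

variable {E : Type*} [NormedAddCommGroup E] {q : ℝ → E} {a b C : ℝ}

theorem aestronglyMeasurable_of_rightContinuous [MeasurableSpace E] [BorelSpace E]
    [SecondCountableTopology E]
    (hq : ∀ s ∈ Ico a b, ContinuousWithinAt q (Ici s) s) :
    AEStronglyMeasurable q (volume.restrict (Ico a b)) := by
  have h : Measurable (indicator (Ico a b) q) := by
    refine measurable_of_rightContinuous fun s => ?_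
    by_cases hs : s ∈ Ico a b
    · refine (hq s hs).congr_of_eventuallyEq ?_ (indicator_of_mem hs q)
      filter_upwards [Ico_mem_nhdsGE hs.2] with r hr
      exact indicator_of_mem (show r ∈ Ico a b from ⟨hs.1.trans hr.1, hr.2⟩) q
    · refine (continuousWithinAt_const (b := (0 : E))).congr_of_eventuallyEq ?_
        (indicator_of_notMem hs q)
      rcases lt_or_ge s a with h | h
      · filter_upwards [Ico_mem_nhdsGE h] with r hr
        exact indicator_of_notMem (fun h' => absurd h'.1 (not_le.2 hr.2)) q
      · filter_upwards [self_mem_nhdsWithin] with r hr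
        exact indicator_of_notMem
          (fun h' => hs ⟨h, lt_of_le_of_lt (mem_Ici.1 hr) h'.2⟩) q
  exact (aestronglyMeasurable_indicator_iff measurableSet_Ico).1 h.aestronglyMeasurable

theorem intervalIntegrable_of_rightContinuous [MeasurableSpace E] [BorelSpace E]
    [SecondCountableTopology E] (hab : a ≤ b)
    (hq : ∀ s ∈ Ico a b, ContinuousWithinAt q (Ici s) s) (hC : ∀ s ∈ Ico a b, ‖q s‖ ≤ C) :
    IntervalIntegrable q volume a b := by
  rw [intervalIntegrable_iff_integrableOn_Ico_of_le hab]
  exact (integrable_const C).mono' (aestronglyMeasurable_of_rightContinuous hq)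
    ((ae_restrict_iff' measurableSet_Ico).2 (Eventually.of_forall hC))

theorem hasDerivWithinAt_integral_of_rightContinuous [NormedSpace ℝ E] [CompleteSpace E]
    [MeasurableSpace E] [BorelSpace E] [SecondCountableTopology E]
    (hq : ∀ s ∈ Ico a b, ContinuousWithinAt q (Ici s) s) (hC : ∀ s ∈ Ico a b, ‖q s‖ ≤ C)
    {s : ℝ} (hs : s ∈ Ico a b) :
    HasDerivWithinAt (fun r => ∫ x in a..r, q x) (q s) (Ici s) s := by
  have hint : IntervalIntegrable q volume a s :=
    intervalIntegrable_of_rightContinuous hs.1 (fun r hr => hq r ⟨hr.1, hr.2.trans hs.2⟩)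
      (fun r hr => hC r ⟨hr.1, hr.2.trans hs.2⟩)
  refine integral_hasDerivWithinAt_right (t := Ioi s) hint ?_
    ((hq s hs).mono Ioi_subset_Ici_self)
  refine ⟨Ioo s b, Ioo_mem_nhdsGT hs.2, (aestronglyMeasurable_of_rightContinuous hq).mono_set ?_⟩
  exact fun r hr => ⟨hs.1.trans hr.1.le, hr.2⟩

theorem continuousOn_integral_of_rightContinuous [NormedSpace ℝ E] [CompleteSpace E]
    [MeasurableSpace E] [BorelSpace E] [SecondCountableTopology E] (hab : a ≤ b)
    (hq : ∀ s ∈ Ico a b, ContinuousWithinAt q (Ici s) s) (hC : ∀ s ∈ Ico a b, ‖q s‖ ≤ C) :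
    ContinuousOn (fun r => ∫ x in a..r, q x) (Icc a b) := by
  have h := intervalIntegrable_of_rightContinuous hab hq hC
  have := continuousOn_primitive_interval (a := a) (b := b) (f := q) (μ := volume) (by
    rw [uIcc_of_le hab]
    exact (intervalIntegrable_iff_integrableOn_Icc_of_le hab).1 h)
  rwa [uIcc_of_le hab] at this

/-- A function with right derivative `q D` is a multiple of the exponential of `∫ q`. -/
theorem eq_mul_exp_integral_of_rightDeriv {D q : ℝ → ℂ} {a b C : ℝ} (hab : a ≤ b)
    (hD : ContinuousOn D (Icc a b))
    (hq : ∀ s ∈ Ico a b, ContinuousWithinAt q (Ici s) s) (hC : ∀ s ∈ Ico a b, ‖q s‖ ≤ C)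
    (hD' : ∀ s ∈ Ico a b, HasDerivWithinAt D (q s * D s) (Ici s) s) :
    D b = D a * Complex.exp (∫ s in a..b, q s) := by
  have hI := continuousOn_integral_of_rightContinuous hab hq hC
  have key := constant_of_has_deriv_right_zero (a := a) (b := b)
    (f := fun r => D r * Complex.exp (-∫ s in a..r, q s))
    (hD.mul (Complex.continuous_exp.comp_continuousOn hI.neg)) (fun s hs => by
      have h1 := (hD' s hs).mul
        (hasDerivWithinAt_integral_of_rightContinuous hq hC hs).neg.cexp
      convert! h1 using 1
      ring) b (right_mem_Icc.2 hab)
  simp only [integral_same, neg_zero, Complex.exp_zero, mul_one] at key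
  rw [← key, mul_assoc, ← Complex.exp_add]
  simp

end RightContinuous

/-! ### Trajectories in the upper half-plane. -/

/-- `w` solves the chordal Loewner equation (right derivatives) on `[a,b]` inside the open upper
half-plane. -/
structure IsUpperFlow (u : ℝ → ℝ) (a b : ℝ) (w : ℝ → ℂ) : Prop where
  continuousOn : ContinuousOn w (Icc a b)
  im_pos : ∀ s ∈ Icc a b, 0 < (w s).im
  rightDeriv : ∀ s ∈ Ico a b, HasDerivWithinAt w (2 / (w s - (u s : ℂ))) (Ici s) s

/-- The Cauchy kernel `1 / (w - u)` along a trajectory. -/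
noncomputable def cauchyKernel (u : ℝ → ℝ) (w : ℝ → ℂ) (s : ℝ) : ℂ := (w s - (u s : ℂ))⁻¹

theorem Complex.norm_inv_sub_ofReal_le {z : ℂ} {y : ℝ} (hy : 0 < y) (hz : y ≤ z.im) (x : ℝ) :
    ‖(z - (x : ℂ))⁻¹‖ ≤ y⁻¹ := by
  rw [norm_inv]
  refine inv_anti₀ hy (hz.trans ?_)
  simpa using (le_abs_self _).trans (Complex.abs_im_le_norm (z - (x : ℂ)))

theorem Complex.im_two_div_sub_ofReal (z : ℂ) (x : ℝ) :
    (2 / (z - (x : ℂ))).im = -(2 / Complex.normSq (z - x)) * z.im := by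
  rw [Complex.div_im]
  simp
  ring

theorem HasDerivWithinAt.complex_im {f : ℝ → ℂ} {f' : ℂ} {s : Set ℝ} {x : ℝ}
    (h : HasDerivWithinAt f f' s x) : HasDerivWithinAt (fun t => (f t).im) f'.im s x :=
  (Complex.imCLM.hasFDerivAt.comp_hasDerivWithinAt x h)

theorem HasDerivWithinAt.complex_conj {f : ℝ → ℂ} {f' : ℂ} {s : Set ℝ} {x : ℝ}
    (h : HasDerivWithinAt f f' s x) :
    HasDerivWithinAt (fun t => (starRingEnd ℂ) (f t)) ((starRingEnd ℂ) f') s x :=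
  ((Complex.conjCLE : ℂ →L[ℝ] ℂ).hasFDerivAt.comp_hasDerivWithinAt x h)

namespace IsUpperFlow

variable {u : ℝ → ℝ} {a b : ℝ} {w w₁ w₂ : ℝ → ℂ}

theorem mono (h : IsUpperFlow u a b w) {a' b' : ℝ} (ha : a ≤ a') (hb : b' ≤ b) :
    IsUpperFlow u a' b' w :=
  ⟨h.continuousOn.mono (Icc_subset_Icc ha hb), fun s hs => h.im_pos s (Icc_subset_Icc ha hb hs),
    fun s hs => h.rightDeriv s (Ico_subset_Ico ha hb hs)⟩

/-- The imaginary part of 2/(w - u) is negative on the upper half-plane. The height at the final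
time therefore bounds every kernel along the trajectory. -/
theorem im_le (h : IsUpperFlow u a b w) {s : ℝ} (hs : s ∈ Icc a b) : (w b).im ≤ (w s).im := by
  have h' := h.mono hs.1 le_rfl
  refine image_le_of_deriv_right_le_deriv_boundary (f := fun r => (w r).im)
    (B := fun _ => (w s).im) (B' := fun _ => 0)
    (Complex.continuous_im.comp_continuousOn h'.continuousOn)
    (fun r hr => (h'.rightDeriv r hr).complex_im) le_rfl continuousOn_const
    (fun r _ => hasDerivWithinAt_const _ _ _) (fun r hr => ?_) (right_mem_Icc.2 hs.2)
  rw [Complex.im_two_div_sub_ofReal, neg_mul]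
  have := h'.im_pos r (Ico_subset_Icc_self hr)
  have := Complex.normSq_nonneg (w r - u r)
  rw [neg_nonpos]
  positivity

theorem ne_ofReal (h : IsUpperFlow u a b w) {s : ℝ} (hs : s ∈ Icc a b) (x : ℝ) :
    w s - (x : ℂ) ≠ 0 := by
  intro h0
  have := h.im_pos s hs
  rw [sub_eq_zero.1 h0, Complex.ofReal_im] at this
  exact this.false

theorem norm_cauchyKernel_le (h : IsUpperFlow u a b w) {s : ℝ} (hs : s ∈ Icc a b) :
    ‖cauchyKernel u w s‖ ≤ ((w b).im)⁻¹ :=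
  Complex.norm_inv_sub_ofReal_le (h.im_pos b ⟨hs.1.trans hs.2, le_rfl⟩) (h.im_le hs) _

theorem continuousWithinAt (h : IsUpperFlow u a b w) {s : ℝ} (hs : s ∈ Ico a b) :
    ContinuousWithinAt w (Ici s) s := (h.rightDeriv s hs).continuousWithinAt

theorem cauchyKernel_continuousWithinAt (h : IsUpperFlow u a b w)
    (hu : ∀ s, 0 ≤ s → ContinuousWithinAt u (Ici s) s) (ha : 0 ≤ a) {s : ℝ} (hs : s ∈ Ico a b) :
    ContinuousWithinAt (cauchyKernel u w) (Ici s) s :=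
  ((h.continuousWithinAt hs).sub
    (Complex.continuous_ofReal.continuousAt.comp_continuousWithinAt (hu s (ha.trans hs.1)))).inv₀
    (h.ne_ofReal (Ico_subset_Icc_self hs) _)

theorem norm_sub_le (h : IsUpperFlow u a b w) (hab : a ≤ b) :
    ‖w b - w a‖ ≤ 2 * ((w b).im)⁻¹ * (b - a) := by
  refine norm_image_sub_le_of_norm_deriv_right_le_segment h.continuousOn h.rightDeriv
    (fun s hs => ?_) b (right_mem_Icc.2 hab)
  have := h.norm_cauchyKernel_le (Ico_subset_Icc_self hs)
  rw [cauchyKernel] at this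
  rw [div_eq_mul_inv, norm_mul]
  norm_num
  simpa using this

theorem norm_mul_kernel_le (h₁ : IsUpperFlow u a b w₁) (h₂ : IsUpperFlow u a b w₂) {s : ℝ}
    (hs : s ∈ Icc a b) :
    ‖cauchyKernel u w₁ s‖ * ‖cauchyKernel u w₂ s‖ ≤ ((w₁ b).im)⁻¹ * ((w₂ b).im)⁻¹ :=
  mul_le_mul (h₁.norm_cauchyKernel_le hs) (h₂.norm_cauchyKernel_le hs) (norm_nonneg _)
    (inv_nonneg.2 (h₁.im_pos b ⟨hs.1.trans hs.2, le_rfl⟩).le)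

/-- The difference of two solutions satisfies a linear equation, because 2/(w₁ - u) - 2/(w₂ - u) =
-2(w₁ - w₂)/((w₁ - u)(w₂ - u)). Uniqueness in both time directions and the difference quotients of
the flow come from this formula. -/
theorem sub_eq (h₁ : IsUpperFlow u a b w₁) (h₂ : IsUpperFlow u a b w₂)
    (hu : ∀ s, 0 ≤ s → ContinuousWithinAt u (Ici s) s) (ha : 0 ≤ a) (hab : a ≤ b) :
    w₁ b - w₂ b = (w₁ a - w₂ a) *
      Complex.exp (∫ s in a..b, -2 * (cauchyKernel u w₁ s * cauchyKernel u w₂ s)) := by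
  refine eq_mul_exp_integral_of_rightDeriv (D := fun s => w₁ s - w₂ s)
    (C := 2 * (((w₁ b).im)⁻¹ * ((w₂ b).im)⁻¹)) hab
    (h₁.continuousOn.sub h₂.continuousOn) (fun s hs => ?_) (fun s hs => ?_) (fun s hs => ?_)
  · exact ((h₁.cauchyKernel_continuousWithinAt hu ha hs).mul
      (h₂.cauchyKernel_continuousWithinAt hu ha hs)).const_mul _
  · simpa using h₁.norm_mul_kernel_le h₂ (Ico_subset_Icc_self hs)
  · convert! (h₁.rightDeriv s hs).sub (h₂.rightDeriv s hs) using 1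
    have e₁ := h₁.ne_ofReal (Ico_subset_Icc_self hs) (u s)
    have e₂ := h₂.ne_ofReal (Ico_subset_Icc_self hs) (u s)
    simp only [cauchyKernel]
    field_simp
    ring

/-- As u is real, the conjugate of a trajectory solves the same equation in the lower half-plane. -/
theorem sub_conj_eq (h₁ : IsUpperFlow u a b w₁) (h₂ : IsUpperFlow u a b w₂)
    (hu : ∀ s, 0 ≤ s → ContinuousWithinAt u (Ici s) s) (ha : 0 ≤ a) (hab : a ≤ b) :
    w₁ b - (starRingEnd ℂ) (w₂ b) = (w₁ a - (starRingEnd ℂ) (w₂ a)) *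
      Complex.exp (∫ s in a..b,
        -2 * (cauchyKernel u w₁ s * (starRingEnd ℂ) (cauchyKernel u w₂ s))) := by
  refine eq_mul_exp_integral_of_rightDeriv (D := fun s => w₁ s - (starRingEnd ℂ) (w₂ s))
    (C := 2 * (((w₁ b).im)⁻¹ * ((w₂ b).im)⁻¹)) hab
    (h₁.continuousOn.sub (Complex.continuous_conj.comp_continuousOn h₂.continuousOn))
    (fun s hs => ?_) (fun s hs => ?_) (fun s hs => ?_)
  · exact ((h₁.cauchyKernel_continuousWithinAt hu ha hs).mul
      (Complex.continuous_conj.continuousAt.comp_continuousWithinAt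
        (h₂.cauchyKernel_continuousWithinAt hu ha hs))).const_mul _
  · simpa using h₁.norm_mul_kernel_le h₂ (Ico_subset_Icc_self hs)
  · convert! (h₁.rightDeriv s hs).sub (h₂.rightDeriv s hs).complex_conj using 1
    have e₁ := h₁.ne_ofReal (Ico_subset_Icc_self hs) (u s)
    have e₂ := h₂.ne_ofReal (Ico_subset_Icc_self hs) (u s)
    have e₃ : (starRingEnd ℂ) (w₂ s) - u s ≠ 0 := by
      have := (map_ne_zero (starRingEnd ℂ)).2 e₂
      rwa [map_sub, Complex.conj_ofReal] at this
    simp only [cauchyKernel, map_inv₀, map_sub, Complex.conj_ofReal, map_div₀, map_ofNat]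
    field_simp
    ring

theorem eq_of_eq_right (h₁ : IsUpperFlow u a b w₁) (h₂ : IsUpperFlow u a b w₂)
    (hu : ∀ s, 0 ≤ s → ContinuousWithinAt u (Ici s) s) (ha : 0 ≤ a) (h : w₁ b = w₂ b) :
    EqOn w₁ w₂ (Icc a b) := by
  intro s hs
  have := (h₁.mono hs.1 le_rfl).sub_eq (h₂.mono hs.1 le_rfl) hu (ha.trans hs.1) hs.2
  rw [h, sub_self, zero_eq_mul] at this
  exact sub_eq_zero.1 (this.resolve_right (Complex.exp_ne_zero _))

theorem eq_of_eq_left (h₁ : IsUpperFlow u a b w₁) (h₂ : IsUpperFlow u a b w₂)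
    (hu : ∀ s, 0 ≤ s → ContinuousWithinAt u (Ici s) s) (ha : 0 ≤ a) (h : w₁ a = w₂ a) :
    EqOn w₁ w₂ (Icc a b) := by
  intro s hs
  have := (h₁.mono le_rfl hs.2).sub_eq (h₂.mono le_rfl hs.2) hu ha hs.1
  rw [h, sub_self, zero_mul] at this
  exact sub_eq_zero.1 this

end IsUpperFlow

/-! ### Backward existence from any point of the upper half-plane. -/

open intervalIntegral in
/-- Global backward solvability of an integral equation with a bounded vector field that is
Lipschitz in space and right-continuous in time along continuous paths. -/
theorem exists_eq_sub_integral_of_lipschitz {F : ℝ → ℂ → ℂ} {a b K C : ℝ} (hab : a ≤ b)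
    (hK : 0 < K) (hLip : ∀ s ∈ Icc a b, ∀ w w', ‖F s w - F s w'‖ ≤ K * ‖w - w'‖)
    (hC : ∀ s ∈ Icc a b, ∀ w, ‖F s w‖ ≤ C)
    (hF : ∀ v : ℝ → ℂ, ContinuousOn v (Icc a b) → ∀ s ∈ Ico a b,
      ContinuousWithinAt (fun r => F r (v r)) (Ici s) s) (z : ℂ) :
    ∃ w : ℝ → ℂ, ContinuousOn w (Icc a b) ∧
      ∀ s ∈ Icc a b, w s = z - ((∫ r in a..b, F r (w r)) - ∫ r in a..s, F r (w r)) := by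
  have hint : ∀ v : ℝ → ℂ, ContinuousOn v (Icc a b) → ∀ s ∈ Icc a b, ∀ t ∈ Icc a b, s ≤ t →
      IntervalIntegrable (fun r => F r (v r)) MeasureTheory.volume s t :=
    fun v hv s hs t ht hst => intervalIntegrable_of_rightContinuous (C := C) hst
      (fun r hr => hF v hv r ⟨hs.1.trans hr.1, hr.2.trans_le ht.2⟩)
      (fun r hr => hC r ⟨hs.1.trans hr.1, hr.2.le.trans ht.2⟩ _)
  -- The exponential weight makes the Picard operator a contraction on the whole interval: the
  -- integral of the weight over [s, b] is less than the weight at s divided by 2K, so the Lipschitz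
  -- constant K turns into 1/2.
  let W : C(Icc a b, ℂ) → ℝ → ℂ := fun v r => (Real.exp (2 * K * (b - r)) : ℂ) * IccExtend hab v r
  have hW : ∀ v, Continuous (W v) := fun v => by
    have : Continuous (IccExtend hab v) := v.continuous.Icc_extend'
    fun_prop
  let J : C(Icc a b, ℂ) → ℝ → ℂ := fun v s =>
    z - ((∫ r in a..b, F r (W v r)) - ∫ r in a..s, F r (W v r))
  have hJ : ∀ v, ContinuousOn (J v) (Icc a b) := fun v =>
    continuousOn_const.sub (continuousOn_const.sub
      (continuousOn_integral_of_rightContinuous hab (hF _ (hW v).continuousOn)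
        (fun s hs => hC s (Ico_subset_Icc_self hs) _)))
  let T : C(Icc a b, ℂ) → C(Icc a b, ℂ) := fun v =>
    ⟨fun s => (Real.exp (-(2 * K * (b - s))) : ℂ) * J v s, by
      have h2 : Continuous fun s : Icc a b => J v s :=
        continuousOn_iff_continuous_domRestrict.1 (hJ v)
      have h1 : Continuous fun s : Icc a b => (Real.exp (-(2 * K * (b - s))) : ℂ) := by
        fun_prop
      exact h1.mul h2⟩
  have hexp : ∀ s, ∫ r in s..b, Real.exp (2 * K * (b - r)) =
      (Real.exp (2 * K * (b - s)) - 1) / (2 * K) := fun s => by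
    rw [integral_eq_sub_of_hasDerivAt (f := fun r => -Real.exp (2 * K * (b - r)) / (2 * K))]
    · simp
      ring
    · intro r _
      have h1 : HasDerivAt (fun r => 2 * K * (b - r)) (2 * K * (-1)) r :=
        ((hasDerivAt_id r).const_sub b).const_mul _
      convert! (h1.exp.neg.div_const (2 * K)) using 1
      field_simp
    · exact (by fun_prop : Continuous fun r => Real.exp (2 * K * (b - r))).intervalIntegrable _ _
  have hT : ContractingWith (1 / 2) T := by
    refine ⟨by norm_num, LipschitzWith.of_dist_le_mul fun v v' => ?_⟩
    refine (ContinuousMap.dist_le (by positivity)).2 fun s => ?_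
    have hsb : (s : ℝ) ≤ b := s.2.2
    have hbmem : b ∈ Icc a b := right_mem_Icc.2 hab
    have hamem : a ∈ Icc a b := left_mem_Icc.2 hab
    have hi := hint _ (hW v).continuousOn
    have hi' := hint _ (hW v').continuousOn
    have e1 : T v s - T v' s = -((Real.exp (-(2 * K * (b - s))) : ℂ) *
        ∫ r in s..b, (F r (W v r) - F r (W v' r))) := by
      rw [integral_sub (hi s s.2 b hbmem hsb) (hi' s s.2 b hbmem hsb),
        ← integral_interval_sub_left (hi a hamem b hbmem hab) (hi a hamem s s.2 s.2.1),
        ← integral_interval_sub_left (hi' a hamem b hbmem hab) (hi' a hamem s s.2 s.2.1)]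
      simp only [T, J, ContinuousMap.coe_mk]
      ring
    have e2 : ‖∫ r in s..b, (F r (W v r) - F r (W v' r))‖ ≤
        ∫ r in s..b, K * dist v v' * Real.exp (2 * K * (b - r)) := by
      refine norm_integral_le_of_norm_le hsb (Eventually.of_forall fun r hr => ?_)
        ((by fun_prop : Continuous fun r => K * dist v v' *
          Real.exp (2 * K * (b - r))).intervalIntegrable _ _)
      have hr' : r ∈ Icc a b := ⟨s.2.1.trans hr.1.le, hr.2⟩
      refine (hLip r hr' _ _).trans ?_
      rw [mul_assoc, mul_comm (dist v v')]
      refine mul_le_mul_of_nonneg_left ?_ hK.le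
      simp only [W]
      rw [← mul_sub, norm_mul, Complex.norm_real, Real.norm_of_nonneg (Real.exp_pos _).le,
        IccExtend_of_mem hab _ hr', IccExtend_of_mem hab _ hr', ← dist_eq_norm]
      exact mul_le_mul_of_nonneg_left (ContinuousMap.dist_apply_le_dist _) (Real.exp_pos _).le
    rw [integral_const_mul, hexp] at e2
    rw [dist_eq_norm, e1, norm_neg, norm_mul, Complex.norm_real,
      Real.norm_of_nonneg (Real.exp_pos _).le]
    refine (mul_le_mul_of_nonneg_left e2 (Real.exp_pos _).le).trans ?_
    have hE : Real.exp (-(2 * K * (b - s))) * Real.exp (2 * K * (b - s)) = 1 := by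
      rw [← Real.exp_add]
      simp
    have : Real.exp (-(2 * K * (b - s))) *
        (K * dist v v' * ((Real.exp (2 * K * (b - s)) - 1) / (2 * K))) =
        dist v v' / 2 * (1 - Real.exp (-(2 * K * (b - s)))) := by
      have e3 : K * dist v v' * ((Real.exp (2 * K * (b - s)) - 1) / (2 * K)) =
          dist v v' / 2 * (Real.exp (2 * K * (b - s)) - 1) := by field_simp
      rw [e3]
      linear_combination (dist v v' / 2) * hE
    rw [this]
    have h3 := Real.exp_pos (-(2 * K * (b - s)))
    have h4 : 0 ≤ dist v v' := dist_nonneg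
    push_cast
    nlinarith
  obtain ⟨v, hv, -⟩ := hT.exists_fixedPoint 0 (edist_ne_top _ _)
  refine ⟨W v, (hW v).continuousOn, fun s hs => ?_⟩
  have h1 : v ⟨s, hs⟩ = (Real.exp (-(2 * K * (b - s))) : ℂ) * J v s := by
    conv_lhs => rw [← hv.eq]
    rfl
  simp only [W]
  rw [IccExtend_of_mem hab _ hs, h1, ← mul_assoc, ← Complex.ofReal_mul, ← Real.exp_add]
  simp [J, W]

namespace Complex

/-- The vertical projection of the plane onto the half-plane `{y ≤ Im}`. -/
noncomputable def clipIm (y : ℝ) (w : ℂ) : ℂ := ⟨w.re, max w.im y⟩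

theorem le_im_clipIm (y : ℝ) (w : ℂ) : y ≤ (clipIm y w).im := le_max_right _ _

theorem clipIm_of_le {y : ℝ} {w : ℂ} (h : y ≤ w.im) : clipIm y w = w :=
  Complex.ext rfl (max_eq_left h)

theorem norm_clipIm_sub_le (y : ℝ) (w w' : ℂ) : ‖clipIm y w - clipIm y w'‖ ≤ ‖w - w'‖ := by
  rw [Complex.norm_def, Complex.norm_def]
  refine Real.sqrt_le_sqrt ?_
  rw [Complex.normSq_apply, Complex.normSq_apply]
  have : |max w.im y - max w'.im y| ≤ |w.im - w'.im| := abs_max_sub_max_le_abs _ _ _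
  have := mul_self_le_mul_self (abs_nonneg _) this
  rw [abs_mul_abs_self, abs_mul_abs_self] at this
  simpa [clipIm] using this

theorem continuous_clipIm (y : ℝ) : Continuous (clipIm y) :=
  (LipschitzWith.of_dist_le_mul (K := 1) fun w w' => by
    simpa [dist_eq_norm] using norm_clipIm_sub_le y w w').continuous

end Complex

/-- Every point of the upper half-plane is the end point of a trajectory. -/
theorem exists_isUpperFlow {u : ℝ → ℝ} (hu : ∀ s, 0 ≤ s → ContinuousWithinAt u (Ici s) s)
    {a b : ℝ} (ha : 0 ≤ a) (hab : a ≤ b) {z : ℂ} (hz : 0 < z.im) :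
    ∃ w, IsUpperFlow u a b w ∧ w b = z := by
  set y := z.im with hy
  -- Clipping at the height of the end point makes the field bounded and globally Lipschitz.
  let F : ℝ → ℂ → ℂ := fun s w => 2 / (Complex.clipIm y w - (u s : ℂ))
  have hne : ∀ w (x : ℝ), Complex.clipIm y w - (x : ℂ) ≠ 0 := fun w x h0 => by
    have h1 := Complex.le_im_clipIm y w
    rw [sub_eq_zero.1 h0, Complex.ofReal_im] at h1
    exact absurd h1 (not_le.2 hz)
  have hb : ∀ w (x : ℝ), ‖(Complex.clipIm y w - (x : ℂ))⁻¹‖ ≤ y⁻¹ := fun w x =>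
    Complex.norm_inv_sub_ofReal_le hz (Complex.le_im_clipIm y w) x
  have hC : ∀ s ∈ Icc a b, ∀ w, ‖F s w‖ ≤ 2 * y⁻¹ := fun s _ w => by
    simp only [F, div_eq_mul_inv, norm_mul]
    exact mul_le_mul (by norm_num) (hb w _) (norm_nonneg _) (by norm_num)
  have hLip : ∀ s ∈ Icc a b, ∀ w w', ‖F s w - F s w'‖ ≤ 2 * (y⁻¹ * y⁻¹) * ‖w - w'‖ :=
    fun s _ w w' => by
      have e : F s w - F s w' = 2 * ((Complex.clipIm y w - (u s : ℂ))⁻¹ *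
          (Complex.clipIm y w' - (u s : ℂ))⁻¹) *
          (Complex.clipIm y w' - Complex.clipIm y w) := by
        have h1 := hne w (u s)
        have h2 := hne w' (u s)
        simp only [F]
        field_simp
        ring
      rw [e, norm_mul, norm_mul, norm_mul, norm_sub_rev w]
      have := hb w (u s)
      have := hb w' (u s)
      have := Complex.norm_clipIm_sub_le y w' w
      rw [Complex.norm_ofNat]
      gcongr
  have hF : ∀ v : ℝ → ℂ, ContinuousOn v (Icc a b) → ∀ s ∈ Ico a b,
      ContinuousWithinAt (fun r => F r (v r)) (Ici s) s := fun v hv s hs => by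
    have h1 : ContinuousWithinAt v (Ici s) s :=
      (hv s (Ico_subset_Icc_self hs)).mono_of_mem_nhdsWithin
        (mem_of_superset (Icc_mem_nhdsGE hs.2) (Icc_subset_Icc_left hs.1))
    exact continuousWithinAt_const.div
      (((Complex.continuous_clipIm y).continuousAt.comp_continuousWithinAt h1).sub
        (Complex.continuous_ofReal.continuousAt.comp_continuousWithinAt (hu s (ha.trans hs.1))))
      (hne _ _)
  obtain ⟨w, hw, hweq⟩ := exists_eq_sub_integral_of_lipschitz hab (by positivity) hLip hC hF z
  have hder : ∀ s ∈ Ico a b, HasDerivWithinAt w (F s (w s)) (Ici s) s := fun s hs => by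
    have h1 := ((hasDerivWithinAt_integral_of_rightContinuous (hF w hw)
      (fun r hr => hC r (Ico_subset_Icc_self hr) _) hs).const_sub
        (∫ r in a..b, F r (w r))).const_sub z
    rw [neg_neg] at h1
    refine h1.congr_of_eventuallyEq ?_ (hweq s (Ico_subset_Icc_self hs))
    filter_upwards [Icc_mem_nhdsGE hs.2] with r hr
    exact hweq r ⟨hs.1.trans hr.1, hr.2⟩
  have hwb : w b = z := by
    rw [hweq b (right_mem_Icc.2 hab)]
    simp
  -- Even the clipped field points downwards in forward time, so the solution ending at height y
  -- stays above y and the clipping never acts.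
  have him : ∀ s ∈ Icc a b, y ≤ (w s).im := fun s hs => by
    have := image_le_of_deriv_right_le_deriv_boundary (f := fun r => (w r).im) (a := s) (b := b)
      (B := fun _ => (w s).im) (B' := fun _ => 0)
      (Complex.continuous_im.comp_continuousOn (hw.mono (Icc_subset_Icc_left hs.1)))
      (fun r hr => (hder r ⟨hs.1.trans hr.1, hr.2⟩).complex_im) le_rfl continuousOn_const
      (fun r _ => hasDerivWithinAt_const _ _ _) (fun r hr => ?_) (right_mem_Icc.2 hs.2)
    · simpa only [hwb] using this
    · simp only [F]
      rw [Complex.im_two_div_sub_ofReal, neg_mul, neg_nonpos]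
      have := hz.le.trans (Complex.le_im_clipIm y (w r))
      have := Complex.normSq_nonneg (Complex.clipIm y (w r) - u r)
      positivity
  refine ⟨w, ⟨hw, fun s hs => hz.trans_le (him s hs), fun s hs => ?_⟩, hwb⟩
  have := hder s hs
  simp only [F] at this
  rwa [Complex.clipIm_of_le (him s (Ico_subset_Icc_self hs))] at this

/-! ### Càdlàg driving functions and their Loewner solutions. -/

namespace CadlagOn

variable {u : ℝ → ℝ}

theorem rightContinuous (hu : CadlagOn u (Ici 0)) (s : ℝ) (hs : 0 ≤ s) :
    ContinuousWithinAt u (Ici s) s := by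
  have := (hu s hs).1
  rwa [inter_eq_right.2 (Ici_subset_Ici.2 hs)] at this

theorem tendsto_leftValue (hu : CadlagOn u (Ici 0)) {s : ℝ} (hs : 0 < s) :
    Tendsto u (𝓝[<] s) (𝓝 (leftValue u s)) := by
  obtain ⟨l, hl⟩ := (hu s hs.le).2
  have h : 𝓝[Ici 0 ∩ Iio s] s = 𝓝[<] s :=
    nhdsWithin_inter_of_mem (mem_nhdsWithin_of_mem_nhds (Ici_mem_nhds hs))
  rw [h] at hl
  rw [leftValue, if_pos hs, leftLim_eq_of_tendsto hl]
  exact hl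

end CadlagOn

namespace IsLoewnerSolution

variable {u : ℝ → ℝ} {t : ℝ} {z : ℂ} {w : ℝ → ℂ}

/-- A solution stays at positive distance from the driving function. -/
theorem exists_le_norm_sub (hu : CadlagOn u (Ici 0)) (h : IsLoewnerSolution u t z w) :
    ∃ δ > 0, ∀ s ∈ Icc 0 t, δ ≤ ‖w s - (u s : ℂ)‖ := by
  refine isCompact_Icc.induction_on (p := fun S => ∃ δ > 0, ∀ s ∈ S, δ ≤ ‖w s - (u s : ℂ)‖)
    ⟨1, one_pos, by simp⟩ (fun S S' hS ⟨δ, h0, h1⟩ => ⟨δ, h0, fun s hs => h1 s (hS hs)⟩)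
    (fun S S' ⟨δ, h0, h1⟩ ⟨δ', h0', h1'⟩ => ⟨min δ δ', lt_min h0 h0', fun s hs => ?_⟩)
    (fun s hs => ?_)
  · rcases hs with hs | hs
    · exact (min_le_left _ _).trans (h1 s hs)
    · exact (min_le_right _ _).trans (h1' s hs)
  -- Applied twice: with the value of u at s from the right, and with its left limit from the left.
  -- This is where avoidance of u_{s-} is needed.
  · have key : ∀ (l : Filter ℝ) (x : ℝ), w s ≠ (x : ℂ) → l ≤ 𝓝[Icc 0 t] s →
        Tendsto u l (𝓝 x) → ∃ δ > 0, ∀ᶠ r in l, δ ≤ ‖w r - (u r : ℂ)‖ := fun l x hx hl hux => by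
      have h0 : 0 < ‖w s - (x : ℂ)‖ := norm_pos_iff.2 (sub_ne_zero.2 hx)
      have h1 : Tendsto (fun r => ‖w r - (u r : ℂ)‖) l (𝓝 ‖w s - (x : ℂ)‖) :=
        (((h.continuousOn s hs).mono_left hl).sub
          ((Complex.continuous_ofReal.tendsto x).comp hux)).norm
      exact ⟨_, half_pos h0, h1.eventually (Ici_mem_nhds (half_lt_self h0))⟩
    obtain ⟨δ, h0, h1⟩ := key (𝓝[Icc 0 t ∩ Ici s] s) (u s) (h.ne_driving s hs).1
      (nhdsWithin_mono _ inter_subset_left)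
      ((hu.rightContinuous s hs.1).mono_left (nhdsWithin_mono _ inter_subset_right))
    obtain ⟨δ', h0', h1'⟩ : ∃ δ > 0, ∀ᶠ r in 𝓝[Icc 0 t ∩ Iio s] s, δ ≤ ‖w r - (u r : ℂ)‖ := by
      rcases hs.1.eq_or_lt with rfl | hpos
      · have : Icc 0 t ∩ Iio (0 : ℝ) = ∅ := by
          ext r
          simp only [mem_inter_iff, mem_Icc, mem_Iio, mem_empty_iff_false, iff_false]
          intro hr
          linarith [hr.1.1]
        rw [this]
        exact ⟨1, one_pos, by simp⟩
      · exact key _ _ (h.ne_driving s hs).2 (nhdsWithin_mono _ inter_subset_left)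
          ((hu.tendsto_leftValue hpos).mono_left (nhdsWithin_mono _ inter_subset_right))
    have e : 𝓝[Icc 0 t] s = 𝓝[Icc 0 t ∩ Ici s] s ⊔ 𝓝[Icc 0 t ∩ Iio s] s := by
      rw [← nhdsWithin_union, ← inter_union_distrib_left, union_comm, Iio_union_Ici, inter_univ]
    refine ⟨_, ?_, min δ δ', lt_min h0 h0', fun r hr => hr⟩
    rw [e]
    exact eventually_sup.2 ⟨h1.mono fun r hr => (min_le_left _ _).trans hr,
      h1'.mono fun r hr => (min_le_right _ _).trans hr⟩

/-- A solution started in the upper half-plane stays there. -/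
theorem isUpperFlow (hu : CadlagOn u (Ici 0)) (h : IsLoewnerSolution u t z w) (hz : 0 < z.im) :
    IsUpperFlow u 0 t w := by
  obtain ⟨δ, hδ, hδw⟩ := h.exists_le_norm_sub hu
  have hne : ∀ s ∈ Icc 0 t, Complex.normSq (w s - u s) ≠ 0 := fun s hs =>
    (Complex.normSq_pos.2 (norm_pos_iff.1 (hδ.trans_le (hδw s hs)))).ne'
  refine ⟨h.continuousOn, fun s hs => ?_, h.rightDeriv⟩
  -- Im w solves a linear equation with the coefficient -2/|w - u|², bounded by 2/δ²; hence it is Im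
  -- z times a positive exponential.
  have key := eq_mul_exp_integral_of_rightDeriv (D := fun r => ((w r).im : ℂ))
    (q := fun r => ((-(2 / Complex.normSq (w r - u r)) : ℝ) : ℂ)) (a := 0) (b := s)
    (C := 2 / δ ^ 2) hs.1
    (Complex.continuous_ofReal.comp_continuousOn (Complex.continuous_im.comp_continuousOn
      (h.continuousOn.mono (Icc_subset_Icc_right hs.2))))
    (fun r hr => ?_) (fun r hr => ?_) (fun r hr => ?_)
  · rw [intervalIntegral.integral_ofReal, ← Complex.ofReal_exp, ← Complex.ofReal_mul,
      Complex.ofReal_inj, h.initial] at key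
    rw [key]
    positivity
  · have hr' : r ∈ Icc 0 t := ⟨hr.1, hr.2.le.trans hs.2⟩
    refine Complex.continuous_ofReal.continuousAt.comp_continuousWithinAt ?_
    refine (continuousWithinAt_const.div
      (Complex.continuous_normSq.continuousAt.comp_continuousWithinAt
        ((h.rightDeriv r ⟨hr.1, hr.2.trans_le hs.2⟩).continuousWithinAt.sub
        (Complex.continuous_ofReal.continuousAt.comp_continuousWithinAt
          (hu.rightContinuous r hr.1)))) (hne r hr')).neg
  · have hr' : r ∈ Icc 0 t := ⟨hr.1, hr.2.le.trans hs.2⟩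
    rw [Complex.norm_real, norm_neg, Real.norm_of_nonneg (by positivity [Complex.normSq_nonneg (w r - u r)]),
      Complex.normSq_eq_norm_sq]
    have := hδw r hr'
    gcongr
  · have h1 := (h.rightDeriv r ⟨hr.1, hr.2.trans_le hs.2⟩).complex_im.ofReal_comp
    rw [Complex.im_two_div_sub_ofReal, Complex.ofReal_mul] at h1
    exact h1

end IsLoewnerSolution

/-! ### The backward flow and the inverse Loewner map. -/

open Classical in
/-- The backward Loewner flow from time `b` to time `a`. -/
noncomputable def backFlow (u : ℝ → ℝ) (a b : ℝ) (z : ℂ) : ℝ → ℂ :=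
  if h : ∃ w, IsUpperFlow u a b w ∧ w b = z then h.choose else 0

section backFlow

variable {u : ℝ → ℝ} {a b : ℝ} {z : ℂ}

theorem backFlow_spec (hu : ∀ s, 0 ≤ s → ContinuousWithinAt u (Ici s) s)
    (ha : 0 ≤ a) (hab : a ≤ b) (hz : 0 < z.im) :
    IsUpperFlow u a b (backFlow u a b z) ∧ backFlow u a b z b = z := by
  have h := exists_isUpperFlow hu ha hab hz
  rw [backFlow, dif_pos h]
  exact h.choose_spec

theorem IsUpperFlow.eqOn_backFlow (hu : ∀ s, 0 ≤ s → ContinuousWithinAt u (Ici s) s)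
    (ha : 0 ≤ a) (hab : a ≤ b) {w : ℝ → ℂ} (h : IsUpperFlow u a b w) :
    EqOn w (backFlow u a b (w b)) (Icc a b) := by
  have h2 := backFlow_spec hu ha hab (h.im_pos b (right_mem_Icc.2 hab))
  exact h.eq_of_eq_right h2.1 hu ha h2.2.symm

theorem im_le_im_backFlow (hu : ∀ s, 0 ≤ s → ContinuousWithinAt u (Ici s) s)
    (ha : 0 ≤ a) (hab : a ≤ b) (hz : 0 < z.im) : z.im ≤ (backFlow u a b z a).im := by
  have h := backFlow_spec hu ha hab hz
  have := h.1.im_le (left_mem_Icc.2 hab)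
  rwa [h.2] at this

theorem backFlow_comp (hu : ∀ s, 0 ≤ s → ContinuousWithinAt u (Ici s) s)
    (ha : 0 ≤ a) (hab : a ≤ b) (hz : 0 < z.im) :
    backFlow u 0 b z 0 = backFlow u 0 a (backFlow u a b z a) 0 := by
  have h := backFlow_spec hu le_rfl (ha.trans hab) hz
  have h1 := (h.1.mono ha le_rfl).eqOn_backFlow hu ha hab (left_mem_Icc.2 hab)
  have h2 := (h.1.mono le_rfl hab).eqOn_backFlow hu le_rfl ha (left_mem_Icc.2 ha)
  rw [h2, h1, h.2]

/-- The inverse Loewner map is the backward flow to time `0`. -/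
theorem loewnerInv_eq_backFlow (hu : CadlagOn u (Ici 0)) {t : ℝ} (ht : 0 ≤ t) (hz : 0 < z.im) :
    loewnerInv u t z = backFlow u 0 t z 0 := by
  have h := backFlow_spec hu.rightContinuous le_rfl ht hz
  set w := backFlow u 0 t z with hw
  have hsol : IsLoewnerSolution u t (w 0) w :=
    ⟨rfl, h.1.continuousOn, fun s hs => ⟨sub_ne_zero.1 (h.1.ne_ofReal hs _),
      sub_ne_zero.1 (h.1.ne_ofReal hs _)⟩, h.1.rightDeriv⟩
  have hdom : w 0 ∈ loewnerDomain u t := ⟨h.1.im_pos 0 (left_mem_Icc.2 ht), w, hsol⟩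
  -- The choices inside `loewnerMap` and `loewnerInv` are harmless: every chosen solution is an
  -- upper trajectory, and such a trajectory is determined by either end point.
  have hmap : ∀ z₀ ∈ loewnerDomain u t, ∃ v, IsUpperFlow u 0 t v ∧ v 0 = z₀ ∧
      loewnerMap u t z₀ = v t := fun z₀ hz₀ => by
    have hc := hz₀.2.choose_spec
    refine ⟨_, hc.isUpperFlow hu hz₀.1, hc.initial, ?_⟩
    rw [loewnerMap, dif_pos hz₀.2]
  have hex : ∃ z₀ ∈ loewnerDomain u t, loewnerMap u t z₀ = z := by
    obtain ⟨v, hv, hv0, hvt⟩ := hmap _ hdom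
    refine ⟨w 0, hdom, ?_⟩
    rw [hvt, hv.eq_of_eq_left h.1 hu.rightContinuous le_rfl hv0 (right_mem_Icc.2 ht), h.2]
  have h1 : loewnerInv u t z ∈ loewnerDomain u t := Function.invFunOn_mem hex
  have h2 : loewnerMap u t (loewnerInv u t z) = z := Function.invFunOn_eq hex
  obtain ⟨v, hv, hv0, hvt⟩ := hmap _ h1
  rw [← hv0]
  refine hv.eq_of_eq_right h.1 hu.rightContinuous le_rfl ?_ (left_mem_Icc.2 ht)
  rw [← hvt, h2, h.2]

end backFlow

/-! ### Difference quotients, holomorphy and a Grunsky inequality. -/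

section flowIntegrals

open intervalIntegral

variable {u : ℝ → ℝ} {a b : ℝ} {z z₁ z₂ : ℂ}

/-- The logarithm of the difference quotient of the backward flow. -/
noncomputable def logQuotient (u : ℝ → ℝ) (a b : ℝ) (z₁ z₂ : ℂ) : ℂ :=
  ∫ s in a..b, 2 * (cauchyKernel u (backFlow u a b z₁) s * cauchyKernel u (backFlow u a b z₂) s)

/-- The logarithm of the reflected difference quotient of the backward flow. -/
noncomputable def logQuotientConj (u : ℝ → ℝ) (a b : ℝ) (z₁ z₂ : ℂ) : ℂ :=
  ∫ s in a..b, 2 * (cauchyKernel u (backFlow u a b z₁) s *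
    (starRingEnd ℂ) (cauchyKernel u (backFlow u a b z₂) s))

theorem backFlow_sub (hu : ∀ s, 0 ≤ s → ContinuousWithinAt u (Ici s) s) (ha : 0 ≤ a)
    (hab : a ≤ b) (h₁ : 0 < z₁.im) (h₂ : 0 < z₂.im) :
    backFlow u a b z₁ a - backFlow u a b z₂ a =
      (z₁ - z₂) * Complex.exp (logQuotient u a b z₁ z₂) := by
  have f₁ := backFlow_spec hu ha hab h₁
  have f₂ := backFlow_spec hu ha hab h₂
  have := f₁.1.sub_eq f₂.1 hu ha hab
  rw [f₁.2, f₂.2] at this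
  rw [this, mul_assoc, ← Complex.exp_add, logQuotient]
  simp only [neg_mul, intervalIntegral.integral_neg, neg_add_cancel, Complex.exp_zero, mul_one]

theorem backFlow_sub_conj (hu : ∀ s, 0 ≤ s → ContinuousWithinAt u (Ici s) s) (ha : 0 ≤ a)
    (hab : a ≤ b) (h₁ : 0 < z₁.im) (h₂ : 0 < z₂.im) :
    backFlow u a b z₁ a - (starRingEnd ℂ) (backFlow u a b z₂ a) =
      (z₁ - (starRingEnd ℂ) z₂) * Complex.exp (logQuotientConj u a b z₁ z₂) := by
  have f₁ := backFlow_spec hu ha hab h₁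
  have f₂ := backFlow_spec hu ha hab h₂
  have := f₁.1.sub_conj_eq f₂.1 hu ha hab
  rw [f₁.2, f₂.2] at this
  rw [this, mul_assoc, ← Complex.exp_add, logQuotientConj]
  simp only [neg_mul, intervalIntegral.integral_neg, neg_add_cancel, Complex.exp_zero, mul_one]

theorem norm_backFlow_sub_self_le (hu : ∀ s, 0 ≤ s → ContinuousWithinAt u (Ici s) s) (ha : 0 ≤ a)
    (hab : a ≤ b) (hz : 0 < z.im) : ‖backFlow u a b z a - z‖ ≤ 2 * (z.im)⁻¹ * (b - a) := by
  have f := backFlow_spec hu ha hab hz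
  have := f.1.norm_sub_le hab
  rwa [f.2, norm_sub_rev] at this

theorem norm_kernel_backFlow_le (hu : ∀ s, 0 ≤ s → ContinuousWithinAt u (Ici s) s) (ha : 0 ≤ a)
    (hab : a ≤ b) (hz : 0 < z.im) {s : ℝ} (hs : s ∈ Icc a b) :
    ‖cauchyKernel u (backFlow u a b z) s‖ ≤ (z.im)⁻¹ := by
  have f := backFlow_spec hu ha hab hz
  have := f.1.norm_cauchyKernel_le hs
  rwa [f.2] at this

theorem norm_logQuotient_le (hu : ∀ s, 0 ≤ s → ContinuousWithinAt u (Ici s) s) (ha : 0 ≤ a)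
    (hab : a ≤ b) (h₁ : 0 < z₁.im) (h₂ : 0 < z₂.im) :
    ‖logQuotient u a b z₁ z₂‖ ≤ 2 * ((z₁.im)⁻¹ * (z₂.im)⁻¹) * (b - a) := by
  have := norm_integral_le_of_norm_le_const (a := a) (b := b) (C := 2 * ((z₁.im)⁻¹ * (z₂.im)⁻¹))
    (f := fun s => 2 * (cauchyKernel u (backFlow u a b z₁) s *
      cauchyKernel u (backFlow u a b z₂) s)) (fun s hs => by
    rw [uIoc_of_le hab] at hs
    have hs' := Ioc_subset_Icc_self hs
    have h1 := norm_kernel_backFlow_le hu ha hab h₁ hs'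
    have h2 := norm_kernel_backFlow_le hu ha hab h₂ hs'
    rw [norm_mul, norm_mul, Complex.norm_ofNat]
    gcongr)
  rwa [abs_of_nonneg (sub_nonneg.2 hab)] at this

theorem norm_backFlow_sub_le (hu : ∀ s, 0 ≤ s → ContinuousWithinAt u (Ici s) s) (ha : 0 ≤ a)
    (hab : a ≤ b) (h₁ : 0 < z₁.im) (h₂ : 0 < z₂.im) :
    ‖backFlow u a b z₁ a - backFlow u a b z₂ a‖ ≤
      ‖z₁ - z₂‖ * Real.exp (2 * ((z₁.im)⁻¹ * (z₂.im)⁻¹) * (b - a)) := by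
  rw [backFlow_sub hu ha hab h₁ h₂, norm_mul, Complex.norm_exp]
  gcongr
  exact (Complex.re_le_norm _).trans (norm_logQuotient_le hu ha hab h₁ h₂)

/-- The resolvent identity reduces this to the distance of the trajectories at time s, which is
estimated by restarting the flow on [s, b]. -/
theorem norm_kernel_backFlow_sub_le (hu : ∀ s, 0 ≤ s → ContinuousWithinAt u (Ici s) s)
    (ha : 0 ≤ a) (hab : a ≤ b) (h₁ : 0 < z₁.im) (h₂ : 0 < z₂.im) {s : ℝ} (hs : s ∈ Icc a b) :
    ‖cauchyKernel u (backFlow u a b z₁) s - cauchyKernel u (backFlow u a b z₂) s‖ ≤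
      ‖z₁ - z₂‖ * Real.exp (2 * ((z₁.im)⁻¹ * (z₂.im)⁻¹) * (b - a)) *
        ((z₁.im)⁻¹ * (z₂.im)⁻¹) := by
  have f₁ := backFlow_spec hu ha hab h₁
  have f₂ := backFlow_spec hu ha hab h₂
  have e₁ := (f₁.1.mono hs.1 le_rfl).eqOn_backFlow hu (ha.trans hs.1) hs.2 (left_mem_Icc.2 hs.2)
  have e₂ := (f₂.1.mono hs.1 le_rfl).eqOn_backFlow hu (ha.trans hs.1) hs.2 (left_mem_Icc.2 hs.2)
  rw [f₁.2] at e₁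
  rw [f₂.2] at e₂
  have hd := norm_backFlow_sub_le hu (ha.trans hs.1) hs.2 h₁ h₂
  rw [← e₁, ← e₂] at hd
  have e : cauchyKernel u (backFlow u a b z₁) s - cauchyKernel u (backFlow u a b z₂) s =
      -(backFlow u a b z₁ s - backFlow u a b z₂ s) *
        (cauchyKernel u (backFlow u a b z₁) s * cauchyKernel u (backFlow u a b z₂) s) := by
    have n₁ := f₁.1.ne_ofReal hs (u s)
    have n₂ := f₂.1.ne_ofReal hs (u s)
    simp only [cauchyKernel]
    field_simp
    ring
  rw [e, norm_mul, norm_neg, norm_mul]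
  have k₁ := norm_kernel_backFlow_le hu ha hab h₁ hs
  have k₂ := norm_kernel_backFlow_le hu ha hab h₂ hs
  have hd' : ‖backFlow u a b z₁ s - backFlow u a b z₂ s‖ ≤
      ‖z₁ - z₂‖ * Real.exp (2 * ((z₁.im)⁻¹ * (z₂.im)⁻¹) * (b - a)) := by
    refine hd.trans ?_
    have := hs.1
    gcongr
  gcongr

theorem kernel_backFlow_continuousWithinAt
    (hu : ∀ s, 0 ≤ s → ContinuousWithinAt u (Ici s) s) (ha : 0 ≤ a) (hab : a ≤ b)
    (hz : 0 < z.im) : ∀ s ∈ Ico a b,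
      ContinuousWithinAt (cauchyKernel u (backFlow u a b z)) (Ici s) s := fun _ hs =>
  (backFlow_spec hu ha hab hz).1.cauchyKernel_continuousWithinAt hu ha hs

theorem intervalIntegrable_kernel_mul (hu : ∀ s, 0 ≤ s → ContinuousWithinAt u (Ici s) s)
    (ha : 0 ≤ a) (hab : a ≤ b) (h₁ : 0 < z₁.im) (h₂ : 0 < z₂.im) :
    IntervalIntegrable (fun s => 2 * (cauchyKernel u (backFlow u a b z₁) s *
      cauchyKernel u (backFlow u a b z₂) s)) MeasureTheory.volume a b := by
  refine intervalIntegrable_of_rightContinuous (C := 2 * ((z₁.im)⁻¹ * (z₂.im)⁻¹)) hab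
    (fun s hs => ((kernel_backFlow_continuousWithinAt hu ha hab h₁ s hs).mul
      (kernel_backFlow_continuousWithinAt hu ha hab h₂ s hs)).const_mul _) (fun s hs => ?_)
  have k₁ := norm_kernel_backFlow_le hu ha hab h₁ (Ico_subset_Icc_self hs)
  have k₂ := norm_kernel_backFlow_le hu ha hab h₂ (Ico_subset_Icc_self hs)
  rw [norm_mul, norm_mul, Complex.norm_ofNat]
  gcongr

theorem intervalIntegrable_kernel_mul_conj (hu : ∀ s, 0 ≤ s → ContinuousWithinAt u (Ici s) s)
    (ha : 0 ≤ a) (hab : a ≤ b) (h₁ : 0 < z₁.im) (h₂ : 0 < z₂.im) :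
    IntervalIntegrable (fun s => 2 * (cauchyKernel u (backFlow u a b z₁) s *
      (starRingEnd ℂ) (cauchyKernel u (backFlow u a b z₂) s))) MeasureTheory.volume a b := by
  refine intervalIntegrable_of_rightContinuous (C := 2 * ((z₁.im)⁻¹ * (z₂.im)⁻¹)) hab
    (fun s hs => ((kernel_backFlow_continuousWithinAt hu ha hab h₁ s hs).mul
      (Complex.continuous_conj.continuousAt.comp_continuousWithinAt
        (kernel_backFlow_continuousWithinAt hu ha hab h₂ s hs))).const_mul _) (fun s hs => ?_)
  have k₁ := norm_kernel_backFlow_le hu ha hab h₁ (Ico_subset_Icc_self hs)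
  have k₂ := norm_kernel_backFlow_le hu ha hab h₂ (Ico_subset_Icc_self hs)
  rw [norm_mul, norm_mul, Complex.norm_ofNat, Complex.norm_conj]
  gcongr

theorem continuousAt_logQuotient (hu : ∀ s, 0 ≤ s → ContinuousWithinAt u (Ici s) s)
    (ha : 0 ≤ a) (hab : a ≤ b) (hz : 0 < z.im) :
    ContinuousAt (fun z' => logQuotient u a b z' z) z := by
  rw [ContinuousAt, tendsto_iff_norm_sub_tendsto_zero]
  have hev : ∀ᶠ z' in 𝓝 z, 0 < z'.im :=
    (isOpen_lt continuous_const Complex.continuous_im).mem_nhds hz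
  let B : ℂ → ℝ := fun z' => 2 * (‖z' - z‖ *
    Real.exp (2 * ((z'.im)⁻¹ * (z.im)⁻¹) * (b - a)) * ((z'.im)⁻¹ * (z.im)⁻¹) * (z.im)⁻¹) * (b - a)
  have hB : Tendsto B (𝓝 z) (𝓝 0) := by
    have hc : ContinuousAt B z := by
      have := hz.ne'
      have h1 : ContinuousAt (fun z' : ℂ => (z'.im)⁻¹) z :=
        Complex.continuous_im.continuousAt.inv₀ this
      fun_prop
    have : B z = 0 := by simp [B]
    rw [← this]
    exact hc
  refine squeeze_zero' (Eventually.of_forall fun _ => norm_nonneg _) (hev.mono fun z' hz' => ?_) hB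
  rw [logQuotient, logQuotient, ← integral_sub (intervalIntegrable_kernel_mul hu ha hab hz' hz)
    (intervalIntegrable_kernel_mul hu ha hab hz hz)]
  refine (norm_integral_le_of_norm_le_const (C := 2 * (‖z' - z‖ *
    Real.exp (2 * ((z'.im)⁻¹ * (z.im)⁻¹) * (b - a)) * ((z'.im)⁻¹ * (z.im)⁻¹) * (z.im)⁻¹))
    fun s hs => ?_).trans_eq (by rw [abs_of_nonneg (sub_nonneg.2 hab)])
  rw [uIoc_of_le hab] at hs
  have hs' := Ioc_subset_Icc_self hs
  rw [← mul_sub, ← sub_mul, norm_mul, norm_mul, Complex.norm_ofNat]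
  have k₁ := norm_kernel_backFlow_sub_le hu ha hab hz' hz hs'
  have k₂ := norm_kernel_backFlow_le hu ha hab hz hs'
  gcongr

/-- The backward flow is holomorphic in the starting point. -/
theorem hasDerivAt_backFlow (hu : ∀ s, 0 ≤ s → ContinuousWithinAt u (Ici s) s)
    (ha : 0 ≤ a) (hab : a ≤ b) (hz : 0 < z.im) :
    HasDerivAt (fun z => backFlow u a b z a) (Complex.exp (logQuotient u a b z z)) z := by
  rw [hasDerivAt_iff_tendsto_slope]
  have hev : ∀ᶠ z' in 𝓝[≠] z, 0 < z'.im := mem_nhdsWithin_of_mem_nhds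
    ((isOpen_lt continuous_const Complex.continuous_im).mem_nhds hz)
  have h1 : Tendsto (fun z' => Complex.exp (logQuotient u a b z' z)) (𝓝[≠] z)
      (𝓝 (Complex.exp (logQuotient u a b z z))) :=
    ((Complex.continuous_exp.continuousAt.comp
      (continuousAt_logQuotient hu ha hab hz)).tendsto).mono_left nhdsWithin_le_nhds
  refine h1.congr' ?_
  filter_upwards [hev, self_mem_nhdsWithin] with z' hz' hne
  rw [slope_def_field, backFlow_sub hu ha hab hz' hz,
    mul_div_cancel_left₀ _ (sub_ne_zero.2 hne)]

theorem Complex.normSq_sub_conj (z₁ z₂ : ℂ) :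
    ‖z₁ - (starRingEnd ℂ) z₂‖ ^ 2 = ‖z₁ - z₂‖ ^ 2 + 4 * (z₁.im * z₂.im) := by
  rw [← Complex.normSq_eq_norm_sq, ← Complex.normSq_eq_norm_sq, Complex.normSq_apply,
    Complex.normSq_apply]
  simp
  ring

/-- A Grunsky-type inequality for the backward flow. -/
theorem norm_logQuotient_add_sub_le (hu : ∀ s, 0 ≤ s → ContinuousWithinAt u (Ici s) s)
    (ha : 0 ≤ a) (hab : a ≤ b) (h₁ : 0 < z₁.im) (h₂ : 0 < z₂.im) :
    ‖logQuotient u a b z₁ z₁ + logQuotient u a b z₂ z₂ - 2 * logQuotient u a b z₁ z₂‖ ≤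
      ‖z₁ - z₂‖ ^ 2 / (4 * (z₁.im * z₂.im)) := by
  set p := cauchyKernel u (backFlow u a b z₁) with hp
  set q := cauchyKernel u (backFlow u a b z₂) with hq
  have i₁₁ := intervalIntegrable_kernel_mul hu ha hab h₁ h₁
  have i₁₂ := intervalIntegrable_kernel_mul hu ha hab h₁ h₂
  have i₂₂ := intervalIntegrable_kernel_mul hu ha hab h₂ h₂
  have j₁₁ := intervalIntegrable_kernel_mul_conj hu ha hab h₁ h₁
  have j₁₂ := intervalIntegrable_kernel_mul_conj hu ha hab h₁ h₂
  have j₂₁ := intervalIntegrable_kernel_mul_conj hu ha hab h₂ h₁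
  have j₂₂ := intervalIntegrable_kernel_mul_conj hu ha hab h₂ h₂
  set S : ℝ := ∫ s in a..b, 2 * ‖p s - q s‖ ^ 2 with hS
  -- The combination is the integral of a square, hence at most S in modulus, and S is a combination
  -- of reflected quotients.
  have e1 : logQuotient u a b z₁ z₁ + logQuotient u a b z₂ z₂ - 2 * logQuotient u a b z₁ z₂ =
      ∫ s in a..b, 2 * (p s - q s) ^ 2 := by
    simp only [logQuotient]
    rw [← integral_const_mul, ← integral_add i₁₁ i₂₂, ← integral_sub (i₁₁.add i₂₂)
      (i₁₂.const_mul 2)]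
    congr 1
    funext s
    ring
  have e2 : (S : ℂ) = logQuotientConj u a b z₁ z₁ + logQuotientConj u a b z₂ z₂ -
      logQuotientConj u a b z₁ z₂ - logQuotientConj u a b z₂ z₁ := by
    simp only [logQuotientConj]
    rw [← integral_add j₁₁ j₂₂, ← integral_sub (j₁₁.add j₂₂) j₁₂,
      ← integral_sub ((j₁₁.add j₂₂).sub j₁₂) j₂₁, hS, ← intervalIntegral.integral_ofReal]
    congr 1
    funext s
    push_cast
    rw [← Complex.mul_conj']
    simp only [map_sub]
    ring
  have hle : ‖logQuotient u a b z₁ z₁ + logQuotient u a b z₂ z₂ -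
      2 * logQuotient u a b z₁ z₂‖ ≤ S := by
    rw [e1]
    refine (norm_integral_le_integral_norm hab).trans_eq ?_
    congr 1
    funext s
    rw [norm_mul, norm_pow, Complex.norm_ofNat]
  refine hle.trans ?_
  set F₁ := backFlow u a b z₁ a
  set F₂ := backFlow u a b z₂ a
  have Y₁ : 0 < F₁.im := h₁.trans_le (im_le_im_backFlow hu ha hab h₁)
  have Y₂ : 0 < F₂.im := h₂.trans_le (im_le_im_backFlow hu ha hab h₂)
  have c₁₁ := backFlow_sub_conj hu ha hab h₁ h₁
  have c₁₂ := backFlow_sub_conj hu ha hab h₁ h₂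
  have c₂₁ := backFlow_sub_conj hu ha hab h₂ h₁
  have c₂₂ := backFlow_sub_conj hu ha hab h₂ h₂
  -- exp S is a quotient of two cross-ratios of the points and their reflections, before and after
  -- the flow. Since |F₁ - conj F₂|² ≥ 4 Im F₁ Im F₂, it is at most 1 + |z₁ - z₂|²/(4 Im z₁ Im z₂),
  -- and S ≤ exp S - 1.
  have e3 : Complex.exp S * ((F₁ - (starRingEnd ℂ) F₂) * (F₂ - (starRingEnd ℂ) F₁)) *
      ((z₁ - (starRingEnd ℂ) z₁) * (z₂ - (starRingEnd ℂ) z₂)) =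
      ((F₁ - (starRingEnd ℂ) F₁) * (F₂ - (starRingEnd ℂ) F₂)) *
      ((z₁ - (starRingEnd ℂ) z₂) * (z₂ - (starRingEnd ℂ) z₁)) := by
    rw [c₁₁, c₁₂, c₂₁, c₂₂, e2, Complex.exp_sub, Complex.exp_sub, Complex.exp_add]
    field_simp
  have e4 := congrArg norm e3
  have hself : ∀ z : ℂ, 0 < z.im → ‖z - (starRingEnd ℂ) z‖ = 2 * z.im := fun z hz => by
    rw [Complex.sub_conj]
    simp [abs_of_pos hz]
  have hsymm : ∀ z z' : ℂ, ‖z' - (starRingEnd ℂ) z‖ = ‖z - (starRingEnd ℂ) z'‖ := fun z z' => by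
    rw [← Complex.norm_conj, map_sub, Complex.conj_conj, norm_sub_rev]
  simp only [norm_mul] at e4
  rw [hself _ h₁, hself _ h₂, hself _ Y₁, hself _ Y₂, hsymm F₁ F₂, hsymm z₁ z₂, ← sq, ← sq,
    Complex.normSq_sub_conj, Complex.normSq_sub_conj, Complex.norm_exp, Complex.ofReal_re] at e4
  have hyy := mul_pos h₁ h₂
  have hYY := mul_pos Y₁ Y₂
  have hE := Real.add_one_le_exp S
  have h5 : Real.exp S * (4 * (z₁.im * z₂.im)) ≤ ‖z₁ - z₂‖ ^ 2 + 4 * (z₁.im * z₂.im) := by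
    have h6 : 0 ≤ ‖F₁ - F₂‖ ^ 2 := sq_nonneg _
    refine le_of_mul_le_mul_right ?_ (mul_pos four_pos hYY)
    have h7 : 0 ≤ Real.exp S * (4 * (z₁.im * z₂.im)) * ‖F₁ - F₂‖ ^ 2 := by positivity
    linear_combination e4 + h7
  rw [le_div_iff₀ (by positivity)]
  nlinarith
end flowIntegrals

/-! ### Distortion from the Grunsky inequality. -/

open Metric in
/-- A zero-free holomorphic function `X` with `X 0 = 1` for which `ζ X' - X + 1` is of second order
has controlled derivative at the origin, hence stays close to `1`. -/
theorem norm_sub_one_le_of_ne_zero {X : ℂ → ℂ} {R A ρ : ℝ} (hρ : 0 < ρ) (hρR : ρ < R)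
    (hX : DifferentiableOn ℂ X (ball 0 R)) (h0 : X 0 = 1) (hne : ∀ ζ ∈ ball (0 : ℂ) R, X ζ ≠ 0)
    (hb : ∀ ζ ∈ ball (0 : ℂ) R, ‖ζ * deriv X ζ - X ζ + 1‖ ≤ A * ‖ζ‖ ^ 2)
    {ζ : ℂ} (hζ : ‖ζ‖ < R) : ‖X ζ - 1‖ ≤ ‖ζ‖ * (A * ρ + 2 / ρ + A * ‖ζ‖) := by
  have hR : 0 < R := hρ.trans hρR
  have hball : ball (0 : ℂ) R ∈ 𝓝 0 := ball_mem_nhds _ hR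
  set H := dslope X 0 with hH
  have hHd : DifferentiableOn ℂ H (ball 0 R) := (Complex.differentiableOn_dslope hball).2 hX
  have hXH : ∀ ζ, X ζ = 1 + ζ * H ζ := fun ζ => by
    have := sub_smul_dslope X 0 ζ
    rw [sub_zero, smul_eq_mul, h0] at this
    rw [hH, this]
    ring
  -- With X = 1 + ζH, the quantity ζX' - X + 1 is exactly ζ²H'.
  have hderiv : ∀ ζ ∈ ball (0 : ℂ) R, ζ ≠ 0 → ‖deriv H ζ‖ ≤ A := fun ζ hζ hζ0 => by
    have hd : HasDerivAt H (deriv H ζ) ζ :=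
      (hHd.differentiableAt (isOpen_ball.mem_nhds hζ)).hasDerivAt
    have hd' : HasDerivAt X (1 * H ζ + ζ * deriv H ζ) ζ := by
      have := ((hasDerivAt_id ζ).mul hd).const_add 1
      refine this.congr_of_eventuallyEq (Eventually.of_forall fun x => ?_)
      simp [hXH x]
    have h1 := hb ζ hζ
    rw [hd'.deriv, hXH ζ] at h1
    have e : ζ * (1 * H ζ + ζ * deriv H ζ) - (1 + ζ * H ζ) + 1 = ζ ^ 2 * deriv H ζ := by ring
    rw [e, norm_mul, norm_pow, mul_comm] at h1
    exact le_of_mul_le_mul_right h1 (by positivity)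
  have hderiv0 : ‖deriv H 0‖ ≤ A := by
    have hc : ContinuousAt (deriv H) 0 :=
      ((hHd.deriv isOpen_ball).differentiableAt hball).continuousAt
    refine le_of_tendsto (hc.norm.tendsto.mono_left (nhdsWithin_le_nhds (s := {0}ᶜ))) ?_
    filter_upwards [self_mem_nhdsWithin, mem_nhdsWithin_of_mem_nhds hball] with x hx hx'
    exact hderiv x hx' hx
  have hlip : ∀ ζ : ℂ, ‖ζ‖ < R → ‖H ζ - H 0‖ ≤ A * ‖ζ‖ := fun ζ hζ => by
    have := (convex_ball (0 : ℂ) R).norm_image_sub_le_of_norm_deriv_le (f := H) (C := A)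
      (fun x hx => hHd.differentiableAt (isOpen_ball.mem_nhds hx))
      (fun x hx => by
        rcases eq_or_ne x 0 with rfl | hx0
        · exact hderiv0
        · exact hderiv x hx hx0) (mem_ball_self hR) (mem_ball_zero_iff.2 hζ)
    simpa using this
  -- Otherwise |X| ≥ ρ(|H 0| - Aρ) - 1 > 1 on the circle of radius ρ, and the maximum principle for
  -- the holomorphic function 1/X contradicts X 0 = 1.
  have hH0 : ‖H 0‖ ≤ A * ρ + 2 / ρ := by
    by_contra! hcon
    set m := ρ * (‖H 0‖ - A * ρ) - 1 with hm
    have hm1 : 1 < m := by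
      have h1 : 2 / ρ < ‖H 0‖ - A * ρ := by linarith
      rw [div_lt_iff₀ hρ] at h1
      linarith
    have hsub : closedBall (0 : ℂ) ρ ⊆ ball 0 R := closedBall_subset_ball hρR
    have hg : DiffContOnCl ℂ (fun ζ => (X ζ)⁻¹) (ball 0 ρ) := by
      refine DifferentiableOn.diffContOnCl ?_
      rw [closure_ball _ hρ.ne']
      exact (hX.mono hsub).inv fun x hx => hne x (hsub hx)
    have := Complex.norm_le_of_forall_mem_frontier_norm_le isBounded_ball hg (C := m⁻¹)
      (fun ζ hζ => ?_) (subset_closure (mem_ball_self hρ))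
    · rw [h0, inv_one, norm_one] at this
      exact absurd this (not_le.2 (inv_lt_one_of_one_lt₀ hm1))
    · rw [frontier_ball _ hρ.ne', mem_sphere_zero_iff_norm] at hζ
      rw [norm_inv]
      refine inv_anti₀ (by linarith) ?_
      have h1 := hlip ζ (hζ.trans_lt hρR)
      have h2 : ‖H 0‖ - A * ρ ≤ ‖H ζ‖ := by
        have := norm_sub_norm_le (H 0) (H ζ)
        rw [norm_sub_rev, hζ] at *
        linarith [norm_sub_rev (H 0) (H ζ)]
      have h3 : ‖ζ * H ζ‖ - 1 ≤ ‖X ζ‖ := by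
        rw [hXH ζ]
        have := norm_sub_norm_le (ζ * H ζ) (-1)
        rw [norm_neg, norm_one, sub_neg_eq_add, add_comm] at this
        exact this
      rw [norm_mul, hζ] at h3
      have := mul_le_mul_of_nonneg_left h2 hρ.le
      linarith
  have e : X ζ - 1 = ζ * H ζ := by rw [hXH ζ]; ring
  rw [e, norm_mul]
  refine mul_le_mul_of_nonneg_left ?_ (norm_nonneg _)
  have := norm_le_norm_add_norm_sub' (H ζ) (H 0)
  linarith [hlip ζ hζ]

section distortion

variable {u : ℝ → ℝ} {a b : ℝ} {z z' : ℂ}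

theorem dslope_backFlow (hu : ∀ s, 0 ≤ s → ContinuousWithinAt u (Ici s) s)
    (ha : 0 ≤ a) (hab : a ≤ b) (hz : 0 < z.im) (hz' : 0 < z'.im) :
    dslope (fun z => backFlow u a b z a) z z' = Complex.exp (logQuotient u a b z' z) := by
  rcases eq_or_ne z' z with rfl | hne
  · rw [dslope_same, (hasDerivAt_backFlow hu ha hab hz).deriv]
  · rw [dslope_of_ne _ hne, slope_def_field, backFlow_sub hu ha hab hz' hz,
      mul_div_cancel_left₀ _ (sub_ne_zero.2 hne)]

/-- The singularity of the difference quotient at z is removable. -/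
theorem differentiableOn_exp_logQuotient (hu : ∀ s, 0 ≤ s → ContinuousWithinAt u (Ici s) s)
    (ha : 0 ≤ a) (hab : a ≤ b) (hz : 0 < z.im) :
    DifferentiableOn ℂ (fun z' => Complex.exp (logQuotient u a b z' z)) {z' | 0 < z'.im} := by
  have hopen : IsOpen {z' : ℂ | 0 < z'.im} := isOpen_lt continuous_const Complex.continuous_im
  have h : DifferentiableOn ℂ (fun z => backFlow u a b z a) {z' | 0 < z'.im} := fun x hx =>
    (hasDerivAt_backFlow hu ha hab hx).differentiableAt.differentiableWithinAt
  exact ((Complex.differentiableOn_dslope (hopen.mem_nhds hz)).2 h).congr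
    fun x hx => (dslope_backFlow hu ha hab hz hx).symm

/-- Local distortion theorem for the backward Loewner flow. -/
theorem norm_exp_logQuotient_le_of_near (hu : ∀ s, 0 ≤ s → ContinuousWithinAt u (Ici s) s)
    (ha : 0 ≤ a) (hab : a ≤ b) (hz : 0 < z.im) (hzz : ‖z' - z‖ ≤ z.im / 20) :
    ‖Complex.exp (logQuotient u a b z' z')‖ ≤ 12 * ‖Complex.exp (logQuotient u a b z z)‖ := by
  set y := z.im with hy
  let E : ℂ → ℂ := fun ζ => Complex.exp (logQuotient u a b (z + ζ) z)
  let c : ℂ := Complex.exp (logQuotient u a b z z)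
  let X : ℂ → ℂ := fun ζ => c / E ζ
  let ε : ℂ → ℂ := fun ζ => logQuotient u a b (z + ζ) (z + ζ) + logQuotient u a b z z -
    2 * logQuotient u a b (z + ζ) z
  have hopen : IsOpen {z' : ℂ | 0 < z'.im} := isOpen_lt continuous_const Complex.continuous_im
  have him : ∀ ζ ∈ Metric.ball (0 : ℂ) (y / 2), y / 2 < (z + ζ).im := fun ζ hζ => by
    rw [mem_ball_zero_iff] at hζ
    have := (abs_le.1 (Complex.abs_im_le_norm ζ)).1
    rw [Complex.add_im]
    linarith
  have him' : ∀ ζ ∈ Metric.ball (0 : ℂ) (y / 2), 0 < (z + ζ).im := fun ζ hζ =>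
    (half_pos hz).trans (him ζ hζ)
  have hε : ∀ ζ ∈ Metric.ball (0 : ℂ) (y / 2), ‖ε ζ‖ ≤ ‖ζ‖ ^ 2 / (2 * y ^ 2) := fun ζ hζ => by
    refine (norm_logQuotient_add_sub_le hu ha hab (him' ζ hζ) hz).trans ?_
    rw [add_sub_cancel_left]
    have := him ζ hζ
    refine div_le_div_of_nonneg_left (by positivity) (by positivity) ?_
    nlinarith
  have hε1 : ∀ ζ ∈ Metric.ball (0 : ℂ) (y / 2), ‖ε ζ‖ ≤ 1 := fun ζ hζ => by
    refine (hε ζ hζ).trans ?_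
    rw [mem_ball_zero_iff] at hζ
    rw [div_le_one (by positivity)]
    nlinarith [norm_nonneg ζ]
  have hE : ∀ ζ ∈ Metric.ball (0 : ℂ) (y / 2), HasDerivAt E (deriv E ζ) ζ := fun ζ hζ => by
    have h1 := (differentiableOn_exp_logQuotient hu ha hab hz).differentiableAt
      (hopen.mem_nhds (him' ζ hζ))
    exact (DifferentiableAt.comp ζ h1 (by fun_prop : DifferentiableAt ℂ (fun ζ => z + ζ) ζ)).hasDerivAt
  have hE0 : ∀ ζ, E ζ ≠ 0 := fun ζ => Complex.exp_ne_zero _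
  have hc0 : c ≠ 0 := Complex.exp_ne_zero _
  have hrel : ∀ ζ ∈ Metric.ball (0 : ℂ) (y / 2), E ζ + ζ * deriv E ζ =
      Complex.exp (logQuotient u a b (z + ζ) (z + ζ)) := fun ζ hζ => by
    have h1 : HasDerivAt (fun x => backFlow u a b z a + x * E x) (1 * E ζ + ζ * deriv E ζ) ζ :=
      ((hasDerivAt_id ζ).mul (hE ζ hζ)).const_add _
    have h2 := (hasDerivAt_backFlow hu ha hab (him' ζ hζ)).comp_const_add z ζ
    have h3 : (fun x => backFlow u a b z a + x * E x) =ᶠ[𝓝 ζ]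
        fun x => backFlow u a b (z + x) a := by
      filter_upwards [Metric.isOpen_ball.mem_nhds hζ] with x hx
      have := backFlow_sub hu ha hab (him' x hx) hz
      rw [add_sub_cancel_left] at this
      simp only [E]
      rw [← this]
      ring
    have := h1.unique (h2.congr_of_eventuallyEq h3)
    simpa using this
  have hexpε : ∀ ζ, Complex.exp (ε ζ) =
      Complex.exp (logQuotient u a b (z + ζ) (z + ζ)) * c / E ζ ^ 2 := fun ζ => by
    simp only [ε, c, E]
    rw [Complex.exp_sub, Complex.exp_add, ← Complex.exp_nat_mul]
    norm_num
  -- Let F be the flow map, so that E is its difference quotient and E + ζE' = F'(z + ζ). For X =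
  -- F'(z)/E this gives ζX' - X = -F'(z)F'(z + ζ)/E² = -exp ε, with ε the Grunsky combination.
  have hbound : ∀ ζ ∈ Metric.ball (0 : ℂ) (y / 2),
      ‖ζ * deriv X ζ - X ζ + 1‖ ≤ (1 / y ^ 2) * ‖ζ‖ ^ 2 := fun ζ hζ => by
    have hd : deriv X ζ = -(c * deriv E ζ) / E ζ ^ 2 := by
      have : HasDerivAt X ((0 * E ζ - c * deriv E ζ) / E ζ ^ 2) ζ :=
        (hasDerivAt_const ζ c).div (hE ζ hζ) (hE0 ζ)
      rw [this.deriv, zero_mul, zero_sub]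
    have e : ζ * deriv X ζ - X ζ + 1 = -(Complex.exp (ε ζ) - 1) := by
      rw [hd, hexpε, ← hrel ζ hζ]
      have := hE0 ζ
      simp only [X]
      field_simp
      ring
    rw [e, norm_neg]
    refine (Complex.norm_exp_sub_one_le (hε1 ζ hζ)).trans ?_
    have := hε ζ hζ
    calc 2 * ‖ε ζ‖ ≤ 2 * (‖ζ‖ ^ 2 / (2 * y ^ 2)) := by gcongr
      _ = (1 / y ^ 2) * ‖ζ‖ ^ 2 := by field_simp
  have hζ0 : z' - z ∈ Metric.ball (0 : ℂ) (y / 2) := by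
    rw [mem_ball_zero_iff]
    linarith
  have hmain := norm_sub_one_le_of_ne_zero (X := X) (ρ := y / 4) (R := y / 2) (A := 1 / y ^ 2)
    (by linarith) (by linarith)
    (fun ζ hζ => ((differentiableAt_const c).div (hE ζ hζ).differentiableAt
      (hE0 ζ)).differentiableWithinAt)
    (by simp only [X, E, add_zero, c]; exact div_self (Complex.exp_ne_zero _))
    (fun ζ _ => div_ne_zero hc0 (hE0 ζ)) hbound (mem_ball_zero_iff.1 hζ0)
  set ζ := z' - z with hζ
  have hzζ : z + ζ = z' := by rw [hζ]; ring
  -- For |ζ| ≤ y/20 the bound is (1/20)(1/4 + 8 + 1/20) < 1/2. Then |E| ≤ 2|F'(z)|, and F'(z') =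
  -- exp(ε) E²/F'(z) with |exp ε| ≤ 3 produces the factor 12.
  have hhalf : ‖X ζ - 1‖ ≤ 1 / 2 := by
    refine hmain.trans ?_
    have : 1 / y ^ 2 * (y / 4) + 2 / (y / 4) + 1 / y ^ 2 * ‖ζ‖ ≤ 9 / y := by
      have h1 : 1 / y ^ 2 * ‖ζ‖ ≤ 1 / y ^ 2 * (y / 20) := by gcongr
      have h2 : 1 / y ^ 2 * (y / 4) + 2 / (y / 4) + 1 / y ^ 2 * (y / 20) = (83 / 10) / y := by
        field_simp
        norm_num
      have h3 : (83 / 10) / y ≤ 9 / y := by gcongr; norm_num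
      linarith
    calc _ ≤ y / 20 * (9 / y) := by gcongr
      _ = 9 / 20 := by field_simp
      _ ≤ 1 / 2 := by norm_num
  have hXge : 1 / 2 ≤ ‖X ζ‖ := by
    have := norm_sub_norm_le 1 (X ζ)
    rw [norm_one, norm_sub_rev] at this
    linarith
  have hEle : ‖E ζ‖ ≤ 2 * ‖c‖ := by
    have h1 : 0 < ‖E ζ‖ := norm_pos_iff.2 (hE0 ζ)
    simp only [X] at hXge
    rw [norm_div, le_div_iff₀ h1] at hXge
    linarith
  have hfin : Complex.exp (logQuotient u a b z' z') = Complex.exp (ε ζ) * E ζ ^ 2 / c := by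
    rw [hexpε, hzζ]
    have := hE0 ζ
    field_simp
  rw [hfin, norm_div, norm_mul, norm_pow, div_le_iff₀ (norm_pos_iff.2 hc0)]
  have h3 : ‖Complex.exp (ε ζ)‖ ≤ 3 := by
    have := Complex.norm_exp_sub_one_le (hε1 ζ hζ0)
    have := norm_le_norm_add_norm_sub' (Complex.exp (ε ζ)) 1
    rw [norm_one] at this
    linarith [hε1 ζ hζ0]
  calc ‖Complex.exp (ε ζ)‖ * ‖E ζ‖ ^ 2 ≤ 3 * (2 * ‖c‖) ^ 2 := by gcongr
    _ = 12 * ‖c‖ * ‖c‖ := by ring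

/-- Distortion theorem for the backward Loewner flow. -/
theorem norm_exp_logQuotient_le (hu : ∀ s, 0 ≤ s → ContinuousWithinAt u (Ici s) s)
    (ha : 0 ≤ a) (hab : a ≤ b) {y : ℝ} (hy : 0 < y) (hz : y ≤ z.im) (n : ℕ) :
    ∀ z' : ℂ, y ≤ z'.im → ‖z' - z‖ ≤ n * (y / 20) →
    ‖Complex.exp (logQuotient u a b z' z')‖ ≤ 12 ^ n * ‖Complex.exp (logQuotient u a b z z)‖ := by
  induction n with
  | zero =>
    intro z' _ h
    simp only [Nat.cast_zero, zero_mul, norm_le_zero_iff, sub_eq_zero] at h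
    simp [h]
  | succ n ih =>
    intro z' hz' h
    push_cast at h
    have hn : (0 : ℝ) < n + 1 := by positivity
    -- The intermediate point is on the segment from z to z', which stays above height y, one step
    -- of length at most y/20 before z'.
    set θ : ℝ := n / (n + 1) with hθ
    have h1θ : 1 - θ = 1 / (n + 1) := by rw [hθ]; field_simp; ring
    have hθ0 : 0 ≤ θ := by positivity
    have hθ1 : 0 ≤ 1 - θ := by rw [h1θ]; positivity
    set x : ℂ := z + (θ : ℂ) * (z' - z) with hx
    have hxim : y ≤ x.im := by
      rw [hx]
      simp only [Complex.add_im, Complex.im_ofReal_mul, Complex.sub_im]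
      nlinarith
    have h1 : ‖x - z‖ ≤ n * (y / 20) := by
      rw [hx, add_sub_cancel_left, norm_mul, Complex.norm_real, Real.norm_of_nonneg hθ0]
      calc θ * ‖z' - z‖ ≤ θ * ((n + 1) * (y / 20)) := by gcongr
        _ = n * (y / 20) := by rw [hθ]; field_simp
    have h2 : ‖z' - x‖ ≤ x.im / 20 := by
      have e : z' - x = ((1 - θ : ℝ) : ℂ) * (z' - z) := by
        rw [hx]
        push_cast
        ring
      rw [e, norm_mul, Complex.norm_real, Real.norm_of_nonneg hθ1, h1θ]
      calc 1 / ((n : ℝ) + 1) * ‖z' - z‖ ≤ 1 / ((n : ℝ) + 1) * ((n + 1) * (y / 20)) := by gcongr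
        _ = y / 20 := by field_simp
        _ ≤ x.im / 20 := by gcongr
    have h3 := norm_exp_logQuotient_le_of_near hu ha hab (hy.trans_le hxim) h2
    have h4 := ih x hxim h1
    rw [pow_succ]
    linarith

end distortion

/-! ### Estimates for the centred inverse map in time and height. -/

section hat

variable {u : ℝ → ℝ} {a b t : ℝ} {z z' : ℂ}

theorem loewnerInvHat_eq (hu : CadlagOn u (Ici 0)) (ht : 0 ≤ t) (hz : 0 < z.im) :
    loewnerInvHat u t z = backFlow u 0 t (z + u t) 0 := by
  rw [loewnerInvHat, loewnerInv_eq_backFlow hu ht (by simpa using hz)]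

theorem deriv_loewnerInvHat (hu : CadlagOn u (Ici 0)) (ht : 0 ≤ t) (hz : 0 < z.im) :
    deriv (loewnerInvHat u t) z = Complex.exp (logQuotient u 0 t (z + u t) (z + u t)) := by
  have h1 := (hasDerivAt_backFlow (z := z + u t) hu.rightContinuous le_rfl ht
    (by simpa using hz)).comp_add_const z (u t : ℂ)
  refine (h1.congr_of_eventuallyEq ?_).deriv
  filter_upwards [(isOpen_lt continuous_const Complex.continuous_im).mem_nhds hz] with x hx
  exact loewnerInvHat_eq hu ht hx

/-- Chain rule along the backward flow. -/
theorem exp_logQuotient_comp (hu : ∀ s, 0 ≤ s → ContinuousWithinAt u (Ici s) s)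
    (ha : 0 ≤ a) (hab : a ≤ b) (hz : 0 < z.im) :
    Complex.exp (logQuotient u 0 b z z) =
      Complex.exp (logQuotient u 0 a (backFlow u a b z a) (backFlow u a b z a)) *
        Complex.exp (logQuotient u a b z z) := by
  have h1 := hasDerivAt_backFlow hu le_rfl (ha.trans hab) hz
  have h2 := (hasDerivAt_backFlow hu le_rfl ha
    (hz.trans_le (im_le_im_backFlow hu ha hab hz))).comp z (hasDerivAt_backFlow hu ha hab hz)
  refine h1.unique (h2.congr_of_eventuallyEq ?_)
  filter_upwards [(isOpen_lt continuous_const Complex.continuous_im).mem_nhds hz] with x hx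
  exact backFlow_comp hu ha hab hx

/-- The derivative bound at time `b` is inherited by slightly earlier times. -/
theorem norm_exp_logQuotient_le_of_le (hu : ∀ s, 0 ≤ s → ContinuousWithinAt u (Ici s) s)
    (ha : 0 ≤ a) (hab : a ≤ b) {y M : ℝ} (hy : 0 < y) (hz : z.im = y) (hba : b - a ≤ y ^ 2)
    (hz' : z'.im = y) (hzz : ‖z' - z‖ ≤ M * y) {n : ℕ} (hn : 20 * (M + 2) ≤ n) :
    ‖Complex.exp (logQuotient u 0 a z' z')‖ ≤
      12 ^ n * (Real.exp 2 * ‖Complex.exp (logQuotient u 0 b z z)‖) := by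
  have hz0 : 0 < z.im := hz ▸ hy
  set x := backFlow u a b z a with hx
  have hxim : y ≤ x.im := hz ▸ im_le_im_backFlow hu ha hab hz0
  have hxz : ‖x - z‖ ≤ 2 * y := by
    refine (norm_backFlow_sub_self_le hu ha hab hz0).trans ?_
    rw [hz]
    calc 2 * y⁻¹ * (b - a) ≤ 2 * y⁻¹ * y ^ 2 := by gcongr
      _ = 2 * y := by field_simp
  have hd : ‖z' - x‖ ≤ n * (y / 20) := by
    have := norm_sub_le_norm_sub_add_norm_sub z' z x
    rw [norm_sub_rev z x] at this
    nlinarith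
  refine (norm_exp_logQuotient_le hu le_rfl ha hy hxim n z' hz'.ge hd).trans ?_
  gcongr
  -- It remains to see that the derivative of the flow over [a, b] has modulus at least exp(-2): its
  -- logarithm is at most 2(b - a)/y² ≤ 2 in modulus.
  rw [exp_logQuotient_comp hu ha hab hz0, norm_mul, ← hx, mul_comm, mul_assoc]
  refine le_mul_of_one_le_right (norm_nonneg _) ?_
  rw [Complex.norm_exp, ← Real.exp_add]
  refine Real.one_le_exp ?_
  have h1 := norm_logQuotient_le hu ha hab hz0 hz0
  have h2 := (abs_le.1 (Complex.abs_re_le_norm (logQuotient u a b z z))).1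
  have h3 : 2 * ((z.im)⁻¹ * (z.im)⁻¹) * (b - a) ≤ 2 := by
    rw [hz]
    calc 2 * (y⁻¹ * y⁻¹) * (b - a) ≤ 2 * (y⁻¹ * y⁻¹) * y ^ 2 := by gcongr
      _ = 2 := by field_simp
  linarith

/-- The increment of the inverse map over a dyadic piece of a vertical ray. -/
theorem norm_loewnerInvHat_sub_le (hu : CadlagOn u (Ici 0)) (ht : 0 ≤ t) {y y' : ℝ} (hy : 0 < y)
    (h1 : y / 2 ≤ y') (h2 : y' ≤ y) :
    ‖loewnerInvHat u t (Complex.I * y') - loewnerInvHat u t (Complex.I * y)‖ ≤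
      12 ^ 21 * ‖deriv (loewnerInvHat u t) (Complex.I * y)‖ * y := by
  have hy' : 0 < y' := by linarith
  have i1 : (Complex.I * y + (u t : ℂ)).im = y := by simp
  have i2 : (Complex.I * y' + (u t : ℂ)).im = y' := by simp
  rw [loewnerInvHat_eq hu ht (by simpa using hy'), loewnerInvHat_eq hu ht (by simpa using hy),
    deriv_loewnerInvHat hu ht (by simpa using hy)]
  set z := Complex.I * y + (u t : ℂ)
  set z' := Complex.I * y' + (u t : ℂ)
  have hzz : ‖z' - z‖ = y - y' := by
    have : z' - z = Complex.I * ((y' - y : ℝ) : ℂ) := by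
      simp only [z, z']
      push_cast
      ring
    rw [this, norm_mul, Complex.norm_I, one_mul, Complex.norm_real, norm_sub_rev,
      Real.norm_of_nonneg (by linarith)]
  have hz : 0 < z.im := i1 ▸ hy
  have hz' : 0 < z'.im := i2 ▸ hy'
  -- Twenty steps of length (y/2)/20 cover the distance y - y' ≤ y/2.
  have hD := norm_exp_logQuotient_le (z := z) hu.rightContinuous le_rfl ht (half_pos hy)
    (by rw [i1]; linarith) 20 z' (by rw [i2]; exact h1) (by rw [hzz]; push_cast; linarith)
  set D := ‖Complex.exp (logQuotient u 0 t z z)‖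
  rw [backFlow_sub hu.rightContinuous le_rfl ht hz' hz, norm_mul, hzz]
  have hG := norm_logQuotient_add_sub_le hu.rightContinuous le_rfl ht hz' hz
  set ε := logQuotient u 0 t z' z' + logQuotient u 0 t z z - 2 * logQuotient u 0 t z' z with hε
  have hε1 : ‖-ε‖ ≤ 1 := by
    rw [norm_neg]
    refine hG.trans ?_
    rw [hzz, i1, i2, div_le_one (by positivity)]
    nlinarith
  have h3 : ‖Complex.exp (-ε)‖ ≤ 3 := by
    have := Complex.norm_exp_sub_one_le hε1
    have := norm_le_norm_add_norm_sub' (Complex.exp (-ε)) 1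
    rw [norm_one] at this
    linarith
  -- The Grunsky inequality makes the squared difference quotient comparable to the product of the
  -- two derivatives, so no integration along the ray is needed.
  have hsq : ‖Complex.exp (logQuotient u 0 t z' z)‖ ^ 2 ≤ (12 ^ 21 * D) ^ 2 := by
    have e : Complex.exp (logQuotient u 0 t z' z) ^ 2 = Complex.exp (logQuotient u 0 t z' z') *
        Complex.exp (logQuotient u 0 t z z) * Complex.exp (-ε) := by
      rw [← Complex.exp_nat_mul, ← Complex.exp_add, ← Complex.exp_add, hε]
      congr 1
      push_cast
      ring
    rw [← norm_pow, e, norm_mul, norm_mul]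
    have hD0 : 0 ≤ D := norm_nonneg _
    calc _ ≤ 12 ^ 20 * D * D * 3 := by gcongr
      _ ≤ (12 ^ 21 * D) ^ 2 := by nlinarith [mul_nonneg hD0 hD0]
  calc (y - y') * ‖Complex.exp (logQuotient u 0 t z' z)‖ ≤ y * (12 ^ 21 * D) := by
        gcongr
        · linarith
        · exact (sq_le_sq₀ (norm_nonneg _) (by positivity)).1 hsq
    _ = 12 ^ 21 * D * y := by ring

/-- The flow over [a, b] moves z by at most 2(b - a)/y without lowering it; the flow over [0, a] is
then Lipschitz above height y. -/
theorem norm_backFlow_sub_backFlow_le (hu : ∀ s, 0 ≤ s → ContinuousWithinAt u (Ici s) s)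
    (ha : 0 ≤ a) (hab : a ≤ b) {y : ℝ} (hy : 0 < y) (hz : z.im = y) (hz' : z'.im = y) :
    ‖backFlow u 0 b z 0 - backFlow u 0 a z' 0‖ ≤
      (‖z - z'‖ + 2 * y⁻¹ * (b - a)) * Real.exp (2 * (y⁻¹ * y⁻¹) * a) := by
  have hz0 : 0 < z.im := hz ▸ hy
  rw [backFlow_comp hu ha hab hz0]
  have him := im_le_im_backFlow hu ha hab hz0
  refine (norm_backFlow_sub_le hu le_rfl ha (hz0.trans_le him) (hz' ▸ hy)).trans ?_
  have h1 := norm_backFlow_sub_self_le hu ha hab hz0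
  have h2 := norm_sub_le_norm_sub_add_norm_sub (backFlow u a b z a) z z'
  rw [hz] at him h1
  have h3 : ((backFlow u a b z a).im)⁻¹ ≤ y⁻¹ := inv_anti₀ hy him
  rw [hz', sub_zero]
  gcongr
  linarith

/-- At a fixed height, `f̂` has a limit along every filter along which `u` has one. -/
theorem tendsto_loewnerInvHat (hu : CadlagOn u (Ici 0)) (ht : 0 ≤ t) {y x : ℝ} (hy : 0 < y)
    {l : Filter ℝ} (hl : l ≤ 𝓝 t) (hl0 : ∀ᶠ τ in l, 0 ≤ τ) (hx : Tendsto u l (𝓝 x)) :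
    Tendsto (fun τ => loewnerInvHat u τ (Complex.I * y)) l
      (𝓝 (backFlow u 0 t (Complex.I * y + x) 0)) := by
  rw [tendsto_iff_norm_sub_tendsto_zero]
  have hid : Tendsto (fun τ : ℝ => τ) l (𝓝 t) := hl
  have hB : Tendsto (fun τ => (|u τ - x| + 2 * y⁻¹ * |τ - t|) *
      Real.exp (2 * (y⁻¹ * y⁻¹) * t)) l (𝓝 0) := by
    have h1 : Tendsto (fun τ => |u τ - x|) l (𝓝 0) := by
      simpa using (hx.sub_const x).abs
    have h2 : Tendsto (fun τ => |τ - t|) l (𝓝 0) := by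
      simpa using (hid.sub_const t).abs
    simpa using (h1.add (h2.const_mul (2 * y⁻¹))).mul_const (Real.exp (2 * (y⁻¹ * y⁻¹) * t))
  refine squeeze_zero' (Eventually.of_forall fun _ => norm_nonneg _) (hl0.mono fun τ hτ => ?_) hB
  rw [loewnerInvHat_eq hu hτ (by simpa using hy)]
  have hn : ‖(Complex.I * y + (u τ : ℂ)) - (Complex.I * y + (x : ℂ))‖ = |u τ - x| := by
    rw [add_sub_add_left_eq_sub, ← Complex.ofReal_sub, Complex.norm_real, Real.norm_eq_abs]
  rcases le_total t τ with h | h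
  · have := norm_backFlow_sub_backFlow_le (z := Complex.I * y + (u τ : ℂ))
      (z' := Complex.I * y + (x : ℂ)) hu.rightContinuous ht h hy (by simp) (by simp)
    rwa [hn, ← abs_of_nonneg (sub_nonneg.2 h)] at this
  · have := norm_backFlow_sub_backFlow_le (z' := Complex.I * y + (u τ : ℂ))
      (z := Complex.I * y + (x : ℂ)) hu.rightContinuous hτ h hy (by simp) (by simp)
    rw [norm_sub_rev (Complex.I * y + (x : ℂ)), hn, ← abs_of_nonneg (sub_nonneg.2 h),
      abs_sub_comm t] at this
    rw [norm_sub_rev]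
    refine this.trans ?_
    gcongr

end hat

/-! ### Dyadic convergence and uniform limits of càdlàg functions. -/

/-- A function with summable oscillation over dyadic intervals converges at `0`. -/
theorem exists_tendsto_of_dyadic_oscillation {G : ℝ → ℂ} {e : ℕ → ℝ} (he : Summable e) {J : ℕ}
    (h : ∀ j, J ≤ j → ∀ y : ℝ, (1 / 2) ^ j / 2 ≤ y → y ≤ (1 / 2) ^ j →
      ‖G y - G ((1 / 2) ^ j)‖ ≤ e j) :
    ∃ l, Tendsto G (𝓝[>] 0) (𝓝 l) ∧
      ∀ j, J ≤ j → ‖l - G ((1 / 2) ^ j)‖ ≤ ∑' m, e (m + j) := by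
  have hd : ∀ j, J ≤ j → dist (G ((1 / 2) ^ j)) (G ((1 / 2) ^ (j + 1))) ≤ e j := fun j hj => by
    rw [dist_comm, dist_eq_norm]
    have hp : (0 : ℝ) < (1 / 2) ^ j := by positivity
    exact h j hj _ (by rw [pow_succ]; linarith) (by rw [pow_succ]; linarith)
  have hsum : ∀ j, Summable fun m => e (m + j) := fun j => (summable_nat_add_iff j).2 he
  have hJ : ∀ n : ℕ, dist (G ((1 / 2) ^ (n + J))) (G ((1 / 2) ^ (n + 1 + J))) ≤ e (n + J) :=
    fun n => by
      have := hd (n + J) (by omega)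
      rwa [show n + J + 1 = n + 1 + J by ring] at this
  obtain ⟨l, hl⟩ := cauchySeq_tendsto_of_complete
    (cauchySeq_of_dist_le_of_summable (fun n => e (n + J)) hJ (hsum J))
  have htail : ∀ j, J ≤ j → ‖l - G ((1 / 2) ^ j)‖ ≤ ∑' m, e (m + j) := fun j hj => by
    obtain ⟨n, rfl⟩ := Nat.exists_eq_add_of_le' hj
    have := dist_le_tsum_of_dist_le_of_tendsto (fun n => e (n + J)) hJ (hsum J) hl n
    rw [dist_comm, dist_eq_norm] at this
    refine this.trans_eq (tsum_congr fun m => ?_)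
    congr 1
    ring
  refine ⟨l, ?_, htail⟩
  rw [Metric.tendsto_nhds]
  intro ε hε
  have hlim : Tendsto (fun j => e j + ∑' m, e (m + j)) atTop (𝓝 0) := by
    simpa using he.tendsto_atTop_zero.add (tendsto_sum_nat_add e)
  obtain ⟨J', hJ'⟩ := eventually_atTop.1 (hlim.eventually (gt_mem_nhds hε))
  have hpos : (0 : ℝ) < (1 / 2) ^ (max J J') := by positivity
  filter_upwards [Ioo_mem_nhdsGT hpos] with y hy
  obtain ⟨j, hj1, hj2⟩ := exists_nat_pow_near_of_lt_one hy.1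
    (hy.2.le.trans (pow_le_one₀ (by norm_num) (by norm_num))) (by norm_num : (0 : ℝ) < 1 / 2)
    (by norm_num)
  have hj : max J J' ≤ j := by
    have := (pow_lt_pow_iff_right_of_lt_one₀ (by norm_num) (by norm_num)).1 (hj1.trans hy.2)
    omega
  have h1 := h j (le_of_max_le_left hj) y (by rw [pow_succ] at hj1; linarith) hj2
  have h2 := htail j (le_of_max_le_left hj)
  have h3 := hJ' j (le_of_max_le_right hj)
  rw [norm_sub_rev] at h2
  rw [dist_eq_norm]
  calc ‖G y - l‖ ≤ ‖G y - G ((1 / 2) ^ j)‖ + ‖G ((1 / 2) ^ j) - l‖ :=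
        norm_sub_le_norm_sub_add_norm_sub _ _ _
    _ < ε := by linarith

/-- Limits along a filter pass to uniform limits of functions. -/
theorem exists_tendsto_of_uniform {ι E : Type*} [NormedAddCommGroup E] [CompleteSpace E]
    {l : Filter ι} {γ : ι → E} {G : ℕ → ι → E} {T : ℕ → ℝ} (hT : Tendsto T atTop (𝓝 0)) {J : ℕ}
    (hG : ∀ j, J ≤ j → ∀ᶠ τ in l, ‖γ τ - G j τ‖ ≤ T j)
    (hlim : ∀ j, J ≤ j → ∃ x, Tendsto (G j) l (𝓝 x)) : ∃ x, Tendsto γ l (𝓝 x) := by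
  rcases l.eq_or_neBot with rfl | hne
  · exact ⟨0, tendsto_bot⟩
  refine cauchy_map_iff_exists_tendsto.1 (Metric.cauchy_iff.2 ⟨hne.map _, fun ε hε => ?_⟩)
  obtain ⟨j, hj, hjJ⟩ := ((hT.eventually (gt_mem_nhds (show 0 < ε / 4 by positivity))).and
    (eventually_ge_atTop J)).exists
  obtain ⟨x, hx⟩ := hlim j hjJ
  have h1 := (hG j hjJ).and (hx.eventually (Metric.ball_mem_nhds x (show 0 < ε / 4 by positivity)))
  refine ⟨γ '' {τ | ‖γ τ - G j τ‖ ≤ T j ∧ G j τ ∈ Metric.ball x (ε / 4)}, image_mem_map h1, ?_⟩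
  have key : ∀ τ, ‖γ τ - G j τ‖ ≤ T j ∧ G j τ ∈ Metric.ball x (ε / 4) → dist (γ τ) x < ε / 2 :=
    fun τ hτ => by
      have := dist_triangle (γ τ) (G j τ) x
      have h2 := hτ.2
      rw [Metric.mem_ball] at h2
      rw [dist_eq_norm (γ τ) (G j τ)] at this
      linarith [hτ.1]
  rintro _ ⟨τ, hτ, rfl⟩ _ ⟨τ', hτ', rfl⟩
  have := dist_triangle_right (γ τ) (γ τ') x
  linarith [key τ hτ, key τ' hτ']

theorem CadlagOn.of_uniform {E : Type*} [NormedAddCommGroup E] [CompleteSpace E]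
    {γ : ℝ → E} {G : ℕ → ℝ → E} {T : ℕ → ℝ} (hT : Tendsto T atTop (𝓝 0)) {I : Set ℝ}
    (hcad : ∀ j, CadlagOn (G j) I)
    (hG : ∀ t ∈ I, ∃ J, ∃ S ∈ 𝓝 t, ∀ j, J ≤ j → ∀ τ ∈ I ∩ S, ‖γ τ - G j τ‖ ≤ T j) :
    CadlagOn γ I := by
  intro t ht
  obtain ⟨J, S, hS, hJ⟩ := hG t ht
  have hev : ∀ K : Set ℝ, ∀ j, J ≤ j → ∀ᶠ τ in 𝓝[I ∩ K] t, ‖γ τ - G j τ‖ ≤ T j := fun K j hj => by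
    filter_upwards [self_mem_nhdsWithin, mem_nhdsWithin_of_mem_nhds hS] with τ h1 h2
    exact hJ j hj τ ⟨h1.1, h2⟩
  refine ⟨?_, exists_tendsto_of_uniform hT (hev _) fun j _ => (hcad j t ht).2⟩
  obtain ⟨x, hx⟩ := exists_tendsto_of_uniform hT (hev (Ici t))
    fun j _ => ⟨_, (hcad j t ht).1⟩
  -- The filter for right continuity contains t itself, which forces the limit to be γ t.
  have : pure t ≤ 𝓝[I ∩ Ici t] t := pure_le_nhdsWithin ⟨ht, self_mem_Ici⟩
  have h1 := hx.mono_left this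
  rw [tendsto_pure_left] at h1
  have h2 : x = γ t := by
    by_contra hne
    exact (h1 {γ t}ᶜ (isOpen_compl_singleton.mem_nhds hne)) rfl
  rw [h2] at hx
  exact hx

/-! ### From marked times to all times of a block. -/

theorem exists_index_le_lt {s : ℕ → ℝ} {τ : ℝ} (h0 : s 0 ≤ τ) :
    ∀ r : ℕ, τ < s (r + 1) → ∃ l ≤ r, s l ≤ τ ∧ τ < s (l + 1)
  | 0, h => ⟨0, le_rfl, h0, h⟩
  | r + 1, h => by
    rcases le_or_gt (s (r + 1)) τ with h1 | h1
    · exact ⟨r + 1, le_rfl, h1, h⟩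
    · obtain ⟨l, hl, h2⟩ := exists_index_le_lt h0 r h1
      exact ⟨l, hl.trans (Nat.le_succ r), h2⟩

/-- The two sums run over the same set, so they cancel whether or not that set is finite. -/
theorem truncated_sub_eq {u : ℝ → ℝ} {β a b : ℝ} {j : ℕ} (hab : a ≤ b)
    (h : ∀ s, a < s → s ≤ b → ¬ (2 : ℝ) ^ (-β * j) < |jump u s|) :
    truncated u β j b - truncated u β j a = u b - u a := by
  have e : {s : ℝ | s ∈ Icc 0 b ∧ (2 : ℝ) ^ (-β * j) < |jump u s|} =
      {s : ℝ | s ∈ Icc 0 a ∧ (2 : ℝ) ^ (-β * j) < |jump u s|} := by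
    ext s
    refine ⟨fun hs => ⟨⟨hs.1.1, ?_⟩, hs.2⟩, fun hs => ⟨⟨hs.1.1, hs.1.2.trans hab⟩, hs.2⟩⟩
    by_contra! hlt
    exact h s hlt hs.1.2 hs.2
  rw [truncated, truncated, e]
  ring

/-- This is the role of β: a jump that is not large is at most the height 2^{-j}, hence absorbed by
distortion. -/
theorem two_rpow_neg_mul_le {β : ℝ} (hβ : 1 < β) (j : ℕ) :
    (2 : ℝ) ^ (-β * j) ≤ (1 / 2) ^ j := by
  have h : ((1 : ℝ) / 2) ^ j = (2 : ℝ) ^ (-(j : ℝ)) := by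
    rw [Real.rpow_neg (by norm_num), Real.rpow_natCast, one_div, inv_pow]
  rw [h]
  refine Real.rpow_le_rpow_of_exponent_le (by norm_num) ?_
  have : (0 : ℝ) ≤ j := Nat.cast_nonneg j
  nlinarith

/-- Control of `f̂'` at all times of a block from its values at the marked times. -/
theorem norm_deriv_loewnerInvHat_le_of_block {u : ℝ → ℝ} (hu : CadlagOn u (Ici 0)) {β : ℝ}
    (hβ : 1 < β) {j r : ℕ} {T : Set ℝ} (hT : T.Finite) {c lo hi B : ℝ} (hlo : 0 ≤ lo)
    (hhi : hi - lo ≤ ((1 / 2) ^ j) ^ 2) {s : ℕ → ℝ} (hs0 : s 0 = lo) (hs1 : s (r + 1) = hi)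
    (hs : ∀ m ≤ r + 1, s m ≤ hi)
    (hjumps : ∀ σ ∈ Ico lo hi, (2 : ℝ) ^ (-β * j) < |jump u σ| → σ ∈ T)
    (hosc : ∀ l ≤ r, ∀ a ∈ Ico (s l) (s (l + 1)), ∀ b ∈ Ico (s l) (s (l + 1)),
      |truncated u β j b - truncated u β j a| ≤ c * (1 / 2) ^ j)
    (ht : ∀ σ ∈ T, ‖deriv (loewnerInvHat u σ)
      (Complex.I * ((1 / 2) ^ j : ℝ) - (jump u σ : ℂ))‖ ≤ B)
    (hds : ∀ m ≤ r + 1, ‖deriv (loewnerInvHat u (s m)) (Complex.I * ((1 / 2) ^ j : ℝ))‖ ≤ B)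
    (hend : (2 : ℝ) ^ (-β * j) < |jump u hi| → ‖deriv (loewnerInvHat u hi)
      (Complex.I * ((1 / 2) ^ j : ℝ) - (jump u hi : ℂ))‖ ≤ B)
    {n : ℕ} (hn : 20 * (c + 3) ≤ n) {τ : ℝ} (hτ : τ ∈ Ico lo hi) :
    ‖deriv (loewnerInvHat u τ) (Complex.I * ((1 / 2) ^ j : ℝ))‖ ≤ 12 ^ n * (Real.exp 2 * B) := by
  set y : ℝ := (1 / 2) ^ j with hy
  have hy0 : 0 < y := by positivity
  have hτ0 : 0 ≤ τ := hlo.trans hτ.1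
  obtain ⟨l, hl, hl1, hl2⟩ := exists_index_le_lt (hs0.trans_le hτ.1) r (hs1 ▸ hτ.2)
  have hlhi : s (l + 1) ≤ hi := hs (l + 1) (by omega)
  -- the right end of the interval around `τ` without large jumps
  obtain ⟨b, hτb, hbs, hfree, hcase⟩ : ∃ b, τ < b ∧ b ≤ s (l + 1) ∧
      (∀ σ, τ < σ → σ < b → ¬ (2 : ℝ) ^ (-β * j) < |jump u σ|) ∧
      ((2 : ℝ) ^ (-β * j) < |jump u b| ∨ b = s (l + 1)) := by
    set Q : Set ℝ := {σ | (τ < σ ∧ σ < s (l + 1)) ∧ (2 : ℝ) ^ (-β * j) < |jump u σ|} with hQ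
    have hfin : Q.Finite := hT.subset fun σ hσ =>
      hjumps σ ⟨hτ.1.trans hσ.1.1.le, hσ.1.2.trans_le hlhi⟩ hσ.2
    rcases Q.eq_empty_or_nonempty with he | hne
    · refine ⟨s (l + 1), hl2, le_rfl, fun σ h1 h2 h3 => ?_, Or.inr rfl⟩
      have : σ ∈ Q := ⟨⟨h1, h2⟩, h3⟩
      rw [he] at this
      exact this
    · obtain ⟨b, hb, hmin⟩ := exists_min_image Q id hfin hne
      refine ⟨b, hb.1.1, hb.1.2.le, fun σ h1 h2 h3 => ?_, Or.inl hb.2⟩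
      exact absurd (hmin σ ⟨⟨h1, h2.trans hb.1.2⟩, h3⟩) (not_le.2 h2)
  have hbhi : b ≤ hi := hbs.trans hlhi
  have hb0 : 0 < b := hτ0.trans_lt hτb
  have hbτ : b - τ ≤ y ^ 2 := by linarith [hτ.1]
  have hu_osc : ∀ σ, τ ≤ σ → σ < b → |u σ - u τ| ≤ c * y := fun σ h1 h2 => by
    rw [← truncated_sub_eq (β := β) (j := j) h1 fun x hx1 hx2 =>
      hfree x hx1 (hx2.trans_lt h2)]
    exact hosc l hl τ ⟨hl1, hl2⟩ σ ⟨hl1.trans h1, h2.trans_le hbs⟩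
  -- Only the left limit at b is controlled, because b itself may carry a large jump.
  have hleft : |leftValue u b - u τ| ≤ c * y := by
    refine le_of_tendsto ((hu.tendsto_leftValue hb0).sub_const (u τ)).abs ?_
    filter_upwards [Ico_mem_nhdsLT hτb] with σ hσ
    exact hu_osc σ hσ.1 hσ.2
  have transfer : ∀ x : ℝ, |x - u τ| ≤ (c + 1) * y →
      ‖Complex.exp (logQuotient u 0 b (Complex.I * y + x) (Complex.I * y + x))‖ ≤ B →
      ‖deriv (loewnerInvHat u τ) (Complex.I * y)‖ ≤ 12 ^ n * (Real.exp 2 * B) := fun x hx hB => by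
    rw [deriv_loewnerInvHat hu hτ0 (by simpa using hy0)]
    refine (norm_exp_logQuotient_le_of_le (z := Complex.I * y + x) (M := c + 1) (n := n)
      hu.rightContinuous hτ0 hτb.le hy0 (by simp) hbτ (by simp) ?_ (by linarith)).trans
      (by gcongr)
    rwa [add_sub_add_left_eq_sub, ← Complex.ofReal_sub, Complex.norm_real, norm_sub_rev,
      Real.norm_eq_abs]
  by_cases hbig : (2 : ℝ) ^ (-β * j) < |jump u b|
  · refine transfer (leftValue u b) (hleft.trans (by linarith)) ?_
    have h1 : ‖deriv (loewnerInvHat u b) (Complex.I * y - (jump u b : ℂ))‖ ≤ B := by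
      rcases hbhi.eq_or_lt with h | h
      · rw [h] at hbig ⊢
        exact hend hbig
      · exact ht b (hjumps b ⟨hτ.1.trans hτb.le, h⟩ hbig)
    rw [deriv_loewnerInvHat hu hb0.le (by simpa using hy0)] at h1
    -- Shifting by the jump in bound 3 places the base point above u_{b-}, which is close to u_τ.
    have e : Complex.I * y - (jump u b : ℂ) + u b = Complex.I * y + (leftValue u b : ℂ) := by
      rw [jump]
      push_cast
      ring
    rwa [e] at h1
  · have hbs' := hcase.resolve_left hbig
    refine transfer (u b) ?_ ?_
    · have h1 : |jump u b| ≤ y := (not_lt.1 hbig).trans (two_rpow_neg_mul_le hβ j)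
      have e : u b - u τ = jump u b + (leftValue u b - u τ) := by
        rw [jump]
        ring
      rw [e]
      refine (abs_add_le _ _).trans ?_
      linarith
    · have h1 := hds (l + 1) (by omega)
      rwa [← hbs', deriv_loewnerInvHat hu hb0.le (by simpa using hy0)] at h1

/-! ### Assembly of the lemma. -/

theorem lemma4p1
    (u : ℝ → ℝ) (hu : CadlagOn u (Ici 0))
    (β : ℝ) (hβ : 1 < β)
    (L N : ℕ) (hL : 0 < L) (hN : 0 < N)
    (r : ℕ → ℕ) (hr_pos : ∀ j, 1 ≤ j → 0 < r j)
    (hr_mono : ∀ i j, 1 ≤ i → i ≤ j → r i ≤ r j)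
    (hr_sum : Summable fun j : ℕ => 1 / (r (j + 1) : ℝ))
    (c : ℝ) (hc : 0 < c) (j₀ : ℕ) (hj₀ : 0 < j₀)
    (t s : ℕ → ℕ → ℕ → ℝ)
    -- the points `t(j,k,1) ≤ … ≤ t(j,k,L)` in the block `[k/2^{2j}, (k+1)/2^{2j})`
    (ht_mem : ∀ j, j₀ ≤ j → ∀ k < N * 2 ^ (2 * j), ∀ l ∈ Finset.Icc 1 L,
      t j k l ∈ Ico ((k : ℝ) / 2 ^ (2 * j)) (((k : ℝ) + 1) / 2 ^ (2 * j)))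
    (ht_mono : ∀ j, j₀ ≤ j → ∀ k < N * 2 ^ (2 * j), ∀ l l' : ℕ,
      1 ≤ l → l ≤ l' → l' ≤ L → t j k l ≤ t j k l')
    -- the points `s(j,k,1) ≤ … ≤ s(j,k,r_j)` in the same block, and the two end points
    (hs_mem : ∀ j, j₀ ≤ j → ∀ k < N * 2 ^ (2 * j), ∀ l ∈ Finset.Icc 1 (r j),
      s j k l ∈ Ico ((k : ℝ) / 2 ^ (2 * j)) (((k : ℝ) + 1) / 2 ^ (2 * j)))
    (hs_mono : ∀ j, j₀ ≤ j → ∀ k < N * 2 ^ (2 * j), ∀ l l' : ℕ,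
      1 ≤ l → l ≤ l' → l' ≤ r j → s j k l ≤ s j k l')
    (hs_zero : ∀ j, j₀ ≤ j → ∀ k < N * 2 ^ (2 * j), s j k 0 = (k : ℝ) / 2 ^ (2 * j))
    (hs_last : ∀ j, j₀ ≤ j → ∀ k < N * 2 ^ (2 * j),
      s j k (r j + 1) = ((k : ℝ) + 1) / 2 ^ (2 * j))
    -- the jumps larger than `2^{-βj}` in the block are among the `t(j,k,l)`
    (h_jumps : ∀ j, j₀ ≤ j → ∀ k < N * 2 ^ (2 * j),
      {τ : ℝ | τ ∈ Ico ((k : ℝ) / 2 ^ (2 * j)) (((k : ℝ) + 1) / 2 ^ (2 * j)) ∧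
        (2 : ℝ) ^ (-β * j) < |jump u τ|} ⊆ {τ : ℝ | ∃ l ∈ Finset.Icc 1 L, τ = t j k l})
    -- the truncated driving function oscillates by at most `c 2^{-j}` between the `s(j,k,l)`
    (h_osc : ∀ j, j₀ ≤ j → ∀ k < N * 2 ^ (2 * j), ∀ l ≤ r j,
      ∀ a ∈ Ico (s j k l) (s j k (l + 1)), ∀ b ∈ Ico (s j k l) (s j k (l + 1)),
        |truncated u β j b - truncated u β j a| ≤ c / 2 ^ j)
    -- the derivative bounds
    (h_deriv_t : ∀ j, j₀ ≤ j → ∀ k < N * 2 ^ (2 * j), ∀ l ∈ Finset.Icc 1 L,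
      ‖deriv (loewnerInvHat u (t j k l))
        (Complex.I / 2 ^ j - (jump u (t j k l) : ℂ))‖ ≤ 2 ^ j / (r j : ℝ) ^ 2)
    (h_deriv_s : ∀ j, j₀ ≤ j → ∀ k < N * 2 ^ (2 * j), ∀ m ≤ r j + 1,
      ‖deriv (loewnerInvHat u (s j k m)) (Complex.I / 2 ^ j)‖ ≤ 2 ^ j / (r j : ℝ) ^ 2) :
    ∃ γ : ℝ → ℂ,
      (∀ τ ∈ Icc (0 : ℝ) N,
        Tendsto (fun y : ℝ => loewnerInvHat u τ (Complex.I * y)) (𝓝[>] 0) (𝓝 (γ τ))) ∧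
      CadlagOn γ (Ico (0 : ℝ) N) ∧
      ((∀ j, j₀ ≤ j → ‖deriv (loewnerInvHat u N)
          (Complex.I / 2 ^ j - (jump u N : ℂ))‖ ≤ 2 ^ j / (r j : ℝ) ^ 2) →
        CadlagOn γ (Icc (0 : ℝ) N)) := by

  have hI : ∀ j : ℕ, Complex.I / 2 ^ j = Complex.I * ((1 / 2 : ℝ) ^ j : ℝ) := fun j => by
    push_cast
    rw [one_div, inv_pow, div_eq_mul_inv]
  have hpow : ∀ j : ℕ, (2 : ℝ) ^ (2 * j) * ((1 / 2) ^ j) ^ 2 = 1 := fun j => by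
    rw [mul_comm 2 j, pow_mul, ← mul_pow, ← mul_pow]
    norm_num
  have hq : ∀ j : ℕ, (0 : ℝ) < 2 ^ (2 * j) := fun j => by positivity
  simp only [hI] at h_deriv_t h_deriv_s ⊢
  obtain ⟨n, hn⟩ := exists_nat_ge (20 * (c + 3))
  set K : ℝ := 12 ^ n * Real.exp 2 with hK
  have hK0 : 0 < K := by positivity
  set B : ℕ → ℝ := fun j => 2 ^ j / (r j : ℝ) ^ 2 with hB
  have hB0 : ∀ j, 0 ≤ B j := fun j => by positivity
  -- The first alternative keeps τ out of the last block of level j; the second supplies the bound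
  -- at N that the last block requires.
  have main : ∀ j, j₀ ≤ j → ∀ τ : ℝ, 0 ≤ τ → τ < N →
      (τ + ((1 / 2) ^ j) ^ 2 < N ∨ ‖deriv (loewnerInvHat u N)
        (Complex.I * ((1 / 2 : ℝ) ^ j : ℝ) - (jump u N : ℂ))‖ ≤ B j) →
      ‖deriv (loewnerInvHat u τ) (Complex.I * ((1 / 2 : ℝ) ^ j : ℝ))‖ ≤ K * B j := by
    intro j hj τ h0 hτN hor
    set k := ⌊τ * 2 ^ (2 * j)⌋₊ with hk
    have hk1 : (k : ℝ) ≤ τ * 2 ^ (2 * j) := Nat.floor_le (by positivity)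
    have hk2 : τ * 2 ^ (2 * j) < k + 1 := Nat.lt_floor_add_one _
    have hkN : k < N * 2 ^ (2 * j) := by
      have h1 : (k : ℝ) < N * 2 ^ (2 * j) := hk1.trans_lt (mul_lt_mul_of_pos_right hτN (hq j))
      exact_mod_cast h1
    have hlen : ((k : ℝ) + 1) / 2 ^ (2 * j) - k / 2 ^ (2 * j) ≤ ((1 / 2) ^ j) ^ 2 := by
      rw [← sub_div, add_sub_cancel_left, div_le_iff₀ (hq j), mul_comm, hpow]
    have hkk : (k : ℝ) / 2 ^ (2 * j) ≤ (k + 1) / 2 ^ (2 * j) := by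
      have := hq j
      gcongr
      linarith
    rw [hK, mul_assoc]
    refine norm_deriv_loewnerInvHat_le_of_block hu hβ (T := {σ | ∃ l ∈ Finset.Icc 1 L, σ = t j k l})
      (c := c) (s := s j k) (r := r j) ?_ (by positivity) hlen (hs_zero j hj k hkN)
      (hs_last j hj k hkN) ?_ ?_ ?_ ?_ ?_ ?_ hn
      ⟨(div_le_iff₀ (hq j)).2 hk1, (lt_div_iff₀ (hq j)).2 hk2⟩
    · exact ((Finset.Icc 1 L).image (t j k)).finite_toSet.subset fun σ hσ => by
        obtain ⟨l, hl, rfl⟩ := hσ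
        exact Finset.mem_coe.2 (Finset.mem_image_of_mem _ hl)
    · intro m hm
      rcases Nat.eq_zero_or_pos m with rfl | hm0
      · rw [hs_zero j hj k hkN]
        exact hkk
      rcases hm.eq_or_lt with rfl | hm1
      · exact (hs_last j hj k hkN).le
      · exact (hs_mem j hj k hkN m (Finset.mem_Icc.2 ⟨hm0, Nat.lt_succ_iff.1 hm1⟩)).2.le
    · exact fun σ h1 h2 => h_jumps j hj k hkN ⟨h1, h2⟩
    · intro l hl a ha b hb
      have := h_osc j hj k hkN l hl a ha b hb
      rwa [one_div, inv_pow, ← div_eq_mul_inv]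
    · rintro σ ⟨l, hl, rfl⟩
      exact h_deriv_t j hj k hkN l hl
    · exact h_deriv_s j hj k hkN
    · intro hbig
      -- A large jump at the right end of block k is at the left end of block k + 1, whose points t
      -- cover it; only the end N lies in no block.
      by_cases hlast : k + 1 < N * 2 ^ (2 * j)
      · obtain ⟨l, hl, hσ⟩ := h_jumps j hj (k + 1) hlast (a := ((k : ℝ) + 1) / 2 ^ (2 * j))
          ⟨⟨by push_cast; exact le_rfl, by
            have := hq j
            push_cast
            gcongr
            linarith⟩, hbig⟩
        rw [hσ]
        exact h_deriv_t j hj (k + 1) hlast l hl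
      · have hkN' : k + 1 = N * 2 ^ (2 * j) := by omega
        have hkN'' : (k : ℝ) + 1 = N * 2 ^ (2 * j) := by exact_mod_cast hkN'
        have hend : ((k : ℝ) + 1) / 2 ^ (2 * j) = N := by
          rw [hkN'', mul_div_cancel_right₀ _ (hq j).ne']
        rw [hend]
        refine hor.resolve_left (not_lt.2 ?_)
        have h1 := (div_le_iff₀ (hq j)).2 hk1
        linarith
  -- N is the point s of index r_j + 1 in the last block, so bound 4 alone gives the existence of
  -- γ(N).
  have hfinal : ∀ j, j₀ ≤ j →
      ‖deriv (loewnerInvHat u N) (Complex.I * ((1 / 2 : ℝ) ^ j : ℝ))‖ ≤ K * B j := by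
    intro j hj
    have hpos : 0 < N * 2 ^ (2 * j) := by positivity
    have hk : N * 2 ^ (2 * j) - 1 < N * 2 ^ (2 * j) := by omega
    have h1 := h_deriv_s j hj _ hk (r j + 1) le_rfl
    have h2 : ((N * 2 ^ (2 * j) - 1 : ℕ) : ℝ) + 1 = N * 2 ^ (2 * j) := by
      rw [Nat.cast_sub hpos]
      push_cast
      ring
    rw [hs_last j hj _ hk, h2, mul_div_cancel_right₀ _ (hq j).ne'] at h1
    refine h1.trans (le_mul_of_one_le_left (hB0 j) ?_)
    have e1 : (1 : ℝ) ≤ 12 ^ n := one_le_pow₀ (by norm_num)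
    have e2 : (1 : ℝ) ≤ Real.exp 2 := Real.one_le_exp (by norm_num)
    exact one_le_mul_of_one_le_of_one_le e1 e2
  -- The factor 2^j in the derivative bound cancels the height 2^{-j}; what remains is summable
  -- because 1/r² ≤ 1/r for integers r ≥ 1.
  set e : ℕ → ℝ := fun j => 12 ^ 21 * K * (1 / (r j : ℝ) ^ 2) with he
  have hesum : Summable e := by
    have h1 : Summable fun j => 1 / (r j : ℝ) := (summable_nat_add_iff 1).1 hr_sum
    refine (Summable.of_nonneg_of_le (fun j => by positivity) (fun j => ?_) h1).mul_left _
    rcases Nat.eq_zero_or_pos (r j) with h | h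
    · simp [h]
    · have : (1 : ℝ) ≤ r j := by exact_mod_cast h
      gcongr
      nlinarith
  set T : ℕ → ℝ := fun j => ∑' m, e (m + j) with hT
  have hTlim : Tendsto T atTop (𝓝 0) := tendsto_sum_nat_add e
  have conv : ∀ τ : ℝ, 0 ≤ τ → ∀ J,
      (∀ j, J ≤ j → ‖deriv (loewnerInvHat u τ) (Complex.I * ((1 / 2 : ℝ) ^ j : ℝ))‖ ≤ K * B j) →
      ∃ l, Tendsto (fun y : ℝ => loewnerInvHat u τ (Complex.I * y)) (𝓝[>] 0) (𝓝 l) ∧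
        ∀ j, J ≤ j → ‖l - loewnerInvHat u τ (Complex.I * ((1 / 2 : ℝ) ^ j : ℝ))‖ ≤ T j := by
    intro τ hτ J hJ
    refine exists_tendsto_of_dyadic_oscillation hesum fun j hj y h1 h2 => ?_
    refine (norm_loewnerInvHat_sub_le hu hτ (by positivity) h1 h2).trans ?_
    have h3 : (2 : ℝ) ^ j * (1 / 2) ^ j = 1 := by rw [← mul_pow]; norm_num
    calc 12 ^ 21 * ‖deriv (loewnerInvHat u τ) (Complex.I * ((1 / 2 : ℝ) ^ j : ℝ))‖ * (1 / 2) ^ j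
        ≤ 12 ^ 21 * (K * B j) * (1 / 2) ^ j := by gcongr; exact hJ j hj
      _ = 12 ^ 21 * K * (1 / (r j : ℝ) ^ 2) * (2 ^ j * (1 / 2) ^ j) := by
          simp only [hB]
          ring
      _ = e j := by rw [h3, mul_one]
  -- bounds uniform on `[0, a]` for `a < N`
  have hunif : ∀ a : ℝ, a < N → ∃ J, ∀ j, J ≤ j → ∀ τ : ℝ, 0 ≤ τ → τ ≤ a →
      ‖deriv (loewnerInvHat u τ) (Complex.I * ((1 / 2 : ℝ) ^ j : ℝ))‖ ≤ K * B j := by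
    intro a ha
    have hlim : Tendsto (fun j : ℕ => a + (((1 : ℝ) / 2) ^ j) ^ 2) atTop (𝓝 a) := by
      simpa using ((tendsto_pow_atTop_nhds_zero_of_lt_one (r := (1 : ℝ) / 2) (by norm_num)
        (by norm_num)).pow 2).const_add a
    obtain ⟨J, hJ⟩ := eventually_atTop.1 (hlim.eventually (gt_mem_nhds ha))
    refine ⟨max J j₀, fun j hj τ h0 h1 => main j (le_of_max_le_right hj) τ h0 (h1.trans_lt ha)
      (Or.inl ?_)⟩
    linarith [hJ j (le_of_max_le_left hj)]
  have hex : ∀ τ ∈ Icc (0 : ℝ) N, ∃ l,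
      Tendsto (fun y : ℝ => loewnerInvHat u τ (Complex.I * y)) (𝓝[>] 0) (𝓝 l) := by
    intro τ hτ
    rcases hτ.2.eq_or_lt with rfl | hlt
    · obtain ⟨l, hl, -⟩ := conv N hτ.1 j₀ hfinal
      exact ⟨l, hl⟩
    · obtain ⟨J, hJ⟩ := hunif τ hlt
      obtain ⟨l, hl, -⟩ := conv τ hτ.1 J fun j hj => hJ j hj τ hτ.1 le_rfl
      exact ⟨l, hl⟩
  choose! γ hγ using hex
  have hclose : ∀ τ ∈ Icc (0 : ℝ) N, ∀ J,
      (∀ j, J ≤ j → ‖deriv (loewnerInvHat u τ) (Complex.I * ((1 / 2 : ℝ) ^ j : ℝ))‖ ≤ K * B j) →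
      ∀ j, J ≤ j → ‖γ τ - loewnerInvHat u τ (Complex.I * ((1 / 2 : ℝ) ^ j : ℝ))‖ ≤ T j := by
    intro τ hτ J hJ
    obtain ⟨l, hl, hlT⟩ := conv τ hτ.1 J hJ
    rwa [tendsto_nhds_unique (hγ τ hτ) hl]
  have hcad : ∀ I : Set ℝ, I ⊆ Ici 0 → ∀ j : ℕ,
      CadlagOn (fun τ => loewnerInvHat u τ (Complex.I * ((1 / 2 : ℝ) ^ j : ℝ))) I := by
    intro I hI0 j τ hτ
    have hτ0 : 0 ≤ τ := hI0 hτ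
    have hy : (0 : ℝ) < (1 / 2) ^ j := by positivity
    have hev : ∀ S : Set ℝ, ∀ᶠ σ in 𝓝[I ∩ S] τ, 0 ≤ σ := fun S => by
      filter_upwards [self_mem_nhdsWithin] with σ hσ
      exact hI0 hσ.1
    obtain ⟨x, hx⟩ := (hu τ hτ0).2
    refine ⟨?_, _, tendsto_loewnerInvHat hu hτ0 hy nhdsWithin_le_nhds (hev _)
      (hx.mono_left (nhdsWithin_mono _ (inter_subset_inter_left _ hI0)))⟩
    have him : 0 < (Complex.I * ((1 / 2 : ℝ) ^ j : ℝ)).im := by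
      rwa [Complex.I_mul_im, Complex.ofReal_re]
    rw [ContinuousWithinAt, loewnerInvHat_eq hu hτ0 him]
    exact tendsto_loewnerInvHat hu hτ0 hy nhdsWithin_le_nhds (hev _)
      ((hu τ hτ0).1.mono_left (nhdsWithin_mono _ (inter_subset_inter_left _ hI0)))
  refine ⟨γ, hγ, ?_, fun hextra => ?_⟩
  · refine CadlagOn.of_uniform hTlim (hcad _ fun τ hτ => hτ.1) fun τ hτ => ?_
    -- The midpoint between τ and N leaves a neighbourhood of τ on which one J serves all times.
    obtain ⟨J, hJ⟩ := hunif ((τ + N) / 2) (by linarith [hτ.2])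
    refine ⟨J, Iic ((τ + N) / 2), Iic_mem_nhds (by linarith [hτ.2]), fun j hj σ hσ => ?_⟩
    exact hclose σ ⟨hσ.1.1, hσ.1.2.le⟩ J (fun i hi => hJ i hi σ hσ.1.1 hσ.2) j hj
  · refine CadlagOn.of_uniform hTlim (hcad _ fun τ hτ => hτ.1) fun τ hτ => ?_
    refine ⟨j₀, univ, univ_mem, fun j hj σ hσ => ?_⟩
    refine hclose σ hσ.1 j₀ (fun i hi => ?_) j hj
    rcases hσ.1.2.eq_or_lt with h | h
    · rw [h]
      exact hfinal i hi
    · exact main i hi σ hσ.1.1 h (Or.inr (hextra i hi))
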